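/- A budgeting scenario $E=(A,V,c,\ell)$ consists of a finite set $A=\{a_1,\dots,a_m\}$ of items, a finite set $V=\{v_1,\dots,v_n\}$ of voters, where each voter $v$ has an approval set $A_v\subseteq A$, a cost function $c\colon A\to\mathbb{N}$ and a budget limit $\ell\in\mathbb{N}$. A budget is a set $B\subseteq A$ with $c(B)=\sum_{b\in B}c(b)\le\ell$. Write $B_v=A_v\cap B$. A winning budget under the rule $\mathcal{R}^m_{|B_v|}$ is a budget $B$ that maximizes the total satisfaction $\sum_{v\in V}|B_v|$ among all budgets of $E$. Proposition. Given a budgeting scenario (its approval sets as a binary matrix, and the costs and the limit in binary), a winning budget under $\mathcal{R}^m_{|B_v|}$ can be computed in polynomial time. That is, there are a function $R$ that assigns to every budgeting scenario $E$ a winning budget $R(E)$ of $E$ under $\mathcal{R}^m_{|B_v|}$, and a deterministic multi-stack Turing machine that on input $E$ halts with output $R(E)$ (given as one bit per item) after a number of steps bounded by a polynomial in the length of the input string. -/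

import Mathlib

/-- A budgeting scenario `E = (A, V, c, ℓ)`: the items are `A = {a_1, …, a_m}` with `m = numItems`,
the voters are `V = {v_1, …, v_n}` with `n = numVoters`, voter `v` approves the items in
`approvals v ⊆ A`, item `a` costs `cost a`, and `limit` is the budget limit `ℓ`. -/
structure BudgetingScenario where
  numItems : ℕ
  numVoters : ℕ
  approvals : Fin numVoters → Finset (Fin numItems)
  cost : Fin numItems → ℕ
  limit : ℕ

namespace BudgetingScenario

/-- The set of items of a scenario. -/
abbrev Item (E : BudgetingScenario) : Type := Fin E.numItems

/-- The set of voters of a scenario. -/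
abbrev Voter (E : BudgetingScenario) : Type := Fin E.numVoters

/-- The total cost `c(B)` of a set of items. -/
def totalCost (E : BudgetingScenario) (B : Finset E.Item) : ℕ := ∑ b ∈ B, E.cost b

/-- A set of items respects the budget limit. -/
def Feasible (E : BudgetingScenario) (B : Finset E.Item) : Prop := E.totalCost B ≤ E.limit

/-- The input string is a sequence of blocks of bits, in this order: the number of voters (binary),
the budget limit (binary) and then, for every item, its cost (binary) followed by its column in the
voters-by-items approval matrix, one bit for each voter. Binary numbers are written with the least
significant bit first. -/
def blocks (E : BudgetingScenario) : List (List Bool) :=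
  Computability.encodeNat E.numVoters :: Computability.encodeNat E.limit ::
    (List.finRange E.numItems).flatMap fun a =>
      [Computability.encodeNat (E.cost a), List.ofFn fun v : E.Voter => decide (a ∈ E.approvals v)]

/-- The input string of a scenario, over the three-letter alphabet consisting of the two bits
`some false`, `some true` and the end-of-block marker `none`. -/
def encode (E : BudgetingScenario) : List (Option Bool) :=
  E.blocks.flatMap fun w => w.map some ++ [none]

end BudgetingScenario

/-- A satisfaction function: in a scenario with set of items `A`, it assigns to the approval set
`A_v ⊆ A` of a voter and a budget `B ⊆ A` the satisfaction `f(A_v, B) ∈ ℕ`. -/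
abbrev SatisfactionFunction : Type :=
  ∀ E : BudgetingScenario, Finset E.Item → Finset E.Item → ℕ

/-- The satisfaction function `f(A_v, B) = |B_v|`, where `B_v = A_v ∩ B`. -/
def cardSatisfaction : SatisfactionFunction := fun _ Av B => (Av ∩ B).card

/-- The sum `∑ v ∈ V, f(A_v, B)` of the voters' satisfaction from the budget `B`. -/
def totalSatisfaction (f : SatisfactionFunction) (E : BudgetingScenario) (B : Finset E.Item) : ℕ :=
  ∑ v : E.Voter, f E (E.approvals v) B

/-- `B` is a winning budget of `E` under the Max rule of the satisfaction function `f`: among the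
sets of items which respect the budget limit, it maximizes the sum of the voters' satisfaction. -/
def IsMaxWinningBudget (f : SatisfactionFunction) (E : BudgetingScenario) (B : Finset E.Item) :
    Prop :=
  E.Feasible B ∧
    ∀ B' : Finset E.Item, E.Feasible B' → totalSatisfaction f E B' ≤ totalSatisfaction f E B

/-- A budgeting method: a function which takes a scenario and returns a budget which respects the
budget limit. -/
structure BudgetingMethod where
  budget : ∀ E : BudgetingScenario, Finset E.Item
  feasible : ∀ E : BudgetingScenario, E.Feasible (budget E)

/-- `R` is the Max rule of `f` (for some way of breaking ties): it always returns a winning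
budget. -/
def BudgetingMethod.IsMaxRule (R : BudgetingMethod) (f : SatisfactionFunction) : Prop :=
  ∀ E : BudgetingScenario, IsMaxWinningBudget f E (R.budget E)

/-- The output string of a budget: one bit for each item, telling whether it is funded. -/
def encodeBudget {m : ℕ} (B : Finset (Fin m)) : List Bool := List.ofFn fun a => decide (a ∈ B)

/-- `R` can be computed by a (multi-stack) Turing machine which, on every scenario, halts with the
budget of `R` as its output, after a number of steps that is bounded by a polynomial in the length
of the input string. -/
def BudgetingMethod.ComputableInPolyTime (R : BudgetingMethod) : Prop :=
  Nonempty (Turing.TM2ComputableInPolyTime BudgetingScenario.encode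
    (Computability.encodingList Bool).encode (fun E => encodeBudget (R.budget E)))

/-! Double counting turns `∑ v, |B_v|` into the sum, over the items in `B`, of the number of their
approvals. A winning budget is therefore an optimal knapsack filling in which an item's value is its
number of approvals. Costs are binary and may be exponential in the input length, but each approval
occupies its own bit of the input, so the total value is at most the input length. Hence a dynamic
program indexed by value is polynomial.

Position `s` of the table holds a cheapest selection of value at least `s`, together with its cost.
For a new item of value `k`, the new entry at `s` is the cheaper of the old entry at `s`, with the
item rejected, and the old entry at `s - k`, with the item accepted. "At least" rather than
"exactly" makes truncated subtraction correct and leaves no position of the table undefined. The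
last entry within the limit is optimal: a feasible selection of value `s` forces the entry at
position `s` to be affordable (`IsOptimalTable.step`, `bestEntry_spec`).

For the running time, the algorithm is written in a small structured language on stacks. Its
relation `Exec` carries an upper bound on the number of steps, and `Exec.reachesIn` shows that the
compiled machine respects this bound. Both the number of entries and the length of an entry grow by
no more than the input consumed, so an item costs quadratic time and the whole run cubic time
(`exec_processItems`, `exec_knapsackCmd`). -/

/-! ### Structured programs on finitely many stacks and their compilation to `TM2` machines -/

namespace StackProgram

/-- The digits stored on the work stacks: choice digits and digits of binary numbers. -/
inductive Digit
  | choice (b : Bool)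
  | bit (b : Bool)
  deriving DecidableEq, Fintype

/-- The alphabet of the work stacks: digits and the end-of-block marker `none`. -/
abbrev Sym : Type := Option Digit

/-- The names of the work stacks. -/
inductive Work
  | T | U | R | S | A | B | C | L
  deriving DecidableEq

instance : Fintype Work :=
  ⟨{.T, .U, .R, .S, .A, .B, .C, .L}, fun w => by cases w <;> decide⟩

/-- The names of all stacks: input, output and work stacks. -/
inductive Stack
  | input
  | output
  | work (w : Work)
  deriving DecidableEq, Fintype

/-- The alphabet of each stack. -/
def Stack.Alphabet : Stack → Type
  | input => Option Bool
  | output => Bool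
  | work _ => Sym

/-- The finite control: two registers for work symbols, one for an input symbol, and a flag. -/
structure Reg where
  x : Option Sym
  y : Option Sym
  i : Option (Option Bool)
  flag : Bool
  deriving DecidableEq, Fintype

/-- The control with empty registers and the given flag. -/
abbrev Reg.ofFlag (b : Bool) : Reg := ⟨none, none, none, b⟩

/-- The contents of the work stacks. -/
@[ext] structure Mem where
  T : List Sym
  U : List Sym
  R : List Sym
  S : List Sym
  A : List Sym
  B : List Sym
  C : List Sym
  L : List Sym

namespace Mem

/-- The content of one work stack. -/
def get (m : Mem) : Work → List Sym
  | .T => m.T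
  | .U => m.U
  | .R => m.R
  | .S => m.S
  | .A => m.A
  | .B => m.B
  | .C => m.C
  | .L => m.L

/-- Replace the content of one work stack. -/
def set (m : Mem) (w : Work) (l : List Sym) : Mem :=
  match w with
  | .T => { m with T := l }
  | .U => { m with U := l }
  | .R => { m with R := l }
  | .S => { m with S := l }
  | .A => { m with A := l }
  | .B => { m with B := l }
  | .C => { m with C := l }
  | .L => { m with L := l }

theorem get_set (m : Mem) (w w' : Work) (l : List Sym) :
    (m.set w l).get w' = if w' = w then l else m.get w' := by
  cases w <;> cases w' <;> rfl

theorem ext_get {m m' : Mem} (h : ∀ w, m.get w = m'.get w) : m = m' :=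
  Mem.ext (h .T) (h .U) (h .R) (h .S) (h .A) (h .B) (h .C) (h .L)

end Mem

/-- The state of a program. -/
structure State where
  reg : Reg
  input : List (Option Bool)
  output : List Bool
  mem : Mem

/-- The stacks of a state, as a `TM2` machine sees them. -/
def State.stk (s : State) : ∀ k : Stack, List k.Alphabet
  | .input => s.input
  | .output => s.output
  | .work w => s.mem.get w

/-- Elementary operations. -/
inductive Op
  | load (g : Reg → Reg)
  | peek (w : Work) (g : Reg → Option Sym → Reg)
  | pop (p : Reg → Bool) (w : Work) (g : Reg → Option Sym → Reg)
  | push (p : Reg → Bool) (w : Work) (g : Reg → Sym)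
  | peekInput (g : Reg → Option (Option Bool) → Reg)
  | popInput (g : Reg → Option (Option Bool) → Reg)
  | pushOutput (p : Reg → Bool) (g : Reg → Bool)

/-- The effect of an elementary operation. -/
def Op.run : Op → State → State
  | load g, s => { s with reg := g s.reg }
  | peek w g, s => { s with reg := g s.reg (s.mem.get w).head? }
  | pop p w g, s => bif p s.reg then
      { s with reg := g s.reg (s.mem.get w).head?, mem := s.mem.set w (s.mem.get w).tail } else s
  | push p w g, s => bif p s.reg then
      { s with mem := s.mem.set w (g s.reg :: s.mem.get w) } else s
  | peekInput g, s => { s with reg := g s.reg s.input.head? }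
  | popInput g, s => { s with reg := g s.reg s.input.head?, input := s.input.tail }
  | pushOutput p g, s => bif p s.reg then { s with output := g s.reg :: s.output } else s

/-- The effect of a sequence of elementary operations. -/
def runOps (l : List Op) (s : State) : State := l.foldl (fun s o => o.run s) s

@[simp] theorem runOps_nil (s : State) : runOps [] s = s := rfl

@[simp] theorem runOps_cons (o : Op) (l : List Op) (s : State) :
    runOps (o :: l) s = runOps l (o.run s) := rfl

/-- Structured programs. -/
inductive Cmd
  | ops (l : List Op)
  | seq (a b : Cmd)
  | ite (pre : List Op) (p : Reg → Bool) (a b : Cmd)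
  | loop (pre : List Op) (p : Reg → Bool) (body : Cmd)

/-- `Exec c s s' n`: the program `c`, started in the state `s`, ends in the state `s'` after at most
`n` steps. -/
inductive Exec : Cmd → State → State → ℕ → Prop
  | ops (l s) : Exec (.ops l) s (runOps l s) 1
  | seq {a b s s₁ s₂ n₁ n₂} : Exec a s s₁ n₁ → Exec b s₁ s₂ n₂ → Exec (.seq a b) s s₂ (n₁ + n₂)
  | ite_true {pre p a b s s' n} : p (runOps pre s).reg = true → Exec a (runOps pre s) s' n →
      Exec (.ite pre p a b) s s' (1 + n)
  | ite_false {pre p a b s s' n} : p (runOps pre s).reg = false → Exec b (runOps pre s) s' n →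
      Exec (.ite pre p a b) s s' (1 + n)
  | loop_exit {pre p body s} : p (runOps pre s).reg = false →
      Exec (.loop pre p body) s (runOps pre s) 1
  | loop_step {pre p body s s₁ s₂ n₁ n₂} : p (runOps pre s).reg = true →
      Exec body (runOps pre s) s₁ n₁ → Exec (.loop pre p body) s₁ s₂ n₂ →
      Exec (.loop pre p body) s s₂ (1 + (n₁ + n₂))
  | mono {c s s' n m} : Exec c s s' n → n ≤ m → Exec c s s' m

theorem Exec.cast {c : Cmd} {s s₁ s₂ : State} {n m : ℕ} (h : Exec c s s₁ n) (hs : s₁ = s₂)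
    (hn : n ≤ m) : Exec c s s₂ m := hs ▸ h.mono hn

open Turing

/-! ### Compilation and step-by-step simulation -/

section Compile

variable {Λ : Type}

/-- Compile one elementary operation, to be followed by the statement `q`. -/
def Op.compile : Op → TM2.Stmt Stack.Alphabet Λ Reg → TM2.Stmt Stack.Alphabet Λ Reg
  | load g, q => .load g q
  | peek w g, q => .peek (.work w) g q
  | pop p w g, q => .branch p (.pop (.work w) g q) q
  | push p w g, q => .branch p (.push (.work w) g q) q
  | peekInput g, q => .peek .input g q
  | popInput g, q => .pop .input g q
  | pushOutput p g, q => .branch p (.push .output g q) q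

/-- Compile a sequence of elementary operations. -/
def compileOps (l : List Op) (q : TM2.Stmt Stack.Alphabet Λ Reg) :
    TM2.Stmt Stack.Alphabet Λ Reg := l.foldr Op.compile q

theorem update_stk_work (s : State) (w : Work) (l : List Sym) :
    Function.update s.stk (.work w) l = State.stk { s with mem := s.mem.set w l } := by
  funext k
  cases k with
  | work w' =>
    by_cases h : w' = w
    · subst h
      exact (Function.update_self ..).trans ((Mem.get_set ..).trans (if_pos rfl)).symm
    · exact (Function.update_of_ne (by simpa using h) ..).trans
        ((Mem.get_set ..).trans (if_neg h)).symm
  | _ => rfl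

theorem update_stk_input (s : State) (l : List (Option Bool)) :
    Function.update s.stk .input l = State.stk { s with input := l } := by
  funext k
  cases k <;> rfl

theorem update_stk_output (s : State) (l : List Bool) :
    Function.update s.stk .output l = State.stk { s with output := l } := by
  funext k
  cases k <;> rfl

theorem stepAux_compile (o : Op) (q : TM2.Stmt Stack.Alphabet Λ Reg) (s : State) :
    TM2.stepAux (o.compile q) s.reg s.stk = TM2.stepAux q (o.run s).reg (o.run s).stk := by
  cases o with
  | load g => rfl
  | peek w g => rfl
  | peekInput g => rfl
  | popInput g => exact congrArg _ (update_stk_input s _)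
  | pop p w g =>
    cases h : p s.reg
    · simp [Op.compile, Op.run, h]
    · simp only [Op.compile, Op.run, h, TM2.stepAux, cond_true]
      exact congrArg _ (update_stk_work s w _)
  | push p w g =>
    cases h : p s.reg
    · simp [Op.compile, Op.run, h]
    · simp only [Op.compile, Op.run, h, TM2.stepAux, cond_true]
      exact congrArg _ (update_stk_work s w _)
  | pushOutput p g =>
    cases h : p s.reg
    · simp [Op.compile, Op.run, h]
    · simp only [Op.compile, Op.run, h, TM2.stepAux, cond_true]
      exact congrArg _ (update_stk_output s _)

/-- A `TM2` machine executes a statement up to its next jump in one step. This is why `Exec` charges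
a single step for a whole list of operations. -/
theorem stepAux_compileOps (l : List Op) (q : TM2.Stmt Stack.Alphabet Λ Reg) (s : State) :
    TM2.stepAux (compileOps l q) s.reg s.stk =
      TM2.stepAux q (runOps l s).reg (runOps l s).stk := by
  induction l generalizing s with
  | nil => rfl
  | cons o l ih => exact (stepAux_compile o _ s).trans (ih _)

/-- The labels of a program. -/
def Cmd.Label : Cmd → Type
  | ops _ => Unit
  | seq a b => a.Label ⊕ b.Label
  | ite _ _ a b => Option (a.Label ⊕ b.Label)
  | loop _ _ body => Option body.Label

/-- A program has finitely many labels. -/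
abbrev Cmd.labelFintype : (c : Cmd) → Fintype c.Label
  | ops _ => inferInstanceAs (Fintype Unit)
  | seq a b => @instFintypeSum _ _ a.labelFintype b.labelFintype
  | ite _ _ a b =>
      @instFintypeOption _ (@instFintypeSum _ _ a.labelFintype b.labelFintype)
  | loop _ _ body => @instFintypeOption _ body.labelFintype

/-- The label at which a program starts. -/
def Cmd.entry : (c : Cmd) → c.Label
  | ops _ => ()
  | seq a _ => .inl a.entry
  | ite _ _ _ _ => none
  | loop _ _ _ => none

/-- The statements of a program, whose labels are renamed by `f` and which continues at the label
`next`. -/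
def Cmd.stmt : (c : Cmd) → (f : c.Label → Λ) → (next : Λ) → c.Label →
    TM2.Stmt Stack.Alphabet Λ Reg
  | ops l, _, next, _ => compileOps l (.goto fun _ => next)
  | seq a b, f, _, .inl l => a.stmt (fun l => f (.inl l)) (f (.inr b.entry)) l
  | seq _ b, f, next, .inr l => b.stmt (fun l => f (.inr l)) next l
  | ite pre p a b, f, _, none =>
      compileOps pre (.branch p (.goto fun _ => f (some (.inl a.entry)))
        (.goto fun _ => f (some (.inr b.entry))))
  | ite _ _ a _, f, next, some (.inl l) => a.stmt (fun l => f (some (.inl l))) next l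
  | ite _ _ _ b, f, next, some (.inr l) => b.stmt (fun l => f (some (.inr l))) next l
  | loop pre p body, f, next, none =>
      compileOps pre (.branch p (.goto fun _ => f (some body.entry)) (.goto fun _ => next))
  | loop _ _ body, f, _, some l => body.stmt (fun l => f (some l)) (f none) l

/-- The configuration at a label in a state. -/
def State.cfg (l : Option Λ) (s : State) : TM2.Cfg Stack.Alphabet Λ Reg := ⟨l, s.reg, s.stk⟩

/-- The machine gets from one configuration to another one in at most `n` steps. -/
def ReachesIn (M : Λ → TM2.Stmt Stack.Alphabet Λ Reg) (a b : TM2.Cfg Stack.Alphabet Λ Reg)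
    (n : ℕ) : Prop :=
  Nonempty (StateTransition.EvalsToInTime (TM2.step M) a (some b) n)

theorem ReachesIn.trans {M : Λ → TM2.Stmt Stack.Alphabet Λ Reg}
    {a b c : TM2.Cfg Stack.Alphabet Λ Reg} {n m : ℕ} (h₁ : ReachesIn M a b n)
    (h₂ : ReachesIn M b c m) : ReachesIn M a c (n + m) := by
  obtain ⟨h₁⟩ := h₁
  obtain ⟨h₂⟩ := h₂
  rw [Nat.add_comm]
  exact ⟨h₁.trans _ _ _ _ _ _ h₂⟩

theorem ReachesIn.single {M : Λ → TM2.Stmt Stack.Alphabet Λ Reg}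
    {a b : TM2.Cfg Stack.Alphabet Λ Reg} (h : TM2.step M a = some b) : ReachesIn M a b 1 :=
  ⟨⟨⟨1, h⟩, le_rfl⟩⟩

theorem ReachesIn.mono {M : Λ → TM2.Stmt Stack.Alphabet Λ Reg}
    {a b : TM2.Cfg Stack.Alphabet Λ Reg} {n m : ℕ} (h : ReachesIn M a b n) (hnm : n ≤ m) :
    ReachesIn M a b m := by
  obtain ⟨h⟩ := h
  exact ⟨⟨h.toEvalsTo, h.steps_le_m.trans hnm⟩⟩

theorem reachesIn_compileOps_goto {M : Λ → TM2.Stmt Stack.Alphabet Λ Reg} {l next : Λ}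
    {pre : List Op} (s : State) (hM : M l = compileOps pre (.goto fun _ => next)) :
    ReachesIn M (s.cfg (some l)) ((runOps pre s).cfg (some next)) 1 := by
  refine .single ?_
  rw [State.cfg, TM2.step, hM, stepAux_compileOps]
  rfl

theorem reachesIn_compileOps_branch {M : Λ → TM2.Stmt Stack.Alphabet Λ Reg} {l l₁ l₂ : Λ}
    {pre : List Op} {p : Reg → Bool} (s : State)
    (hM : M l = compileOps pre (.branch p (.goto fun _ => l₁) (.goto fun _ => l₂))) :
    ReachesIn M (s.cfg (some l))
      ((runOps pre s).cfg (some (bif p (runOps pre s).reg then l₁ else l₂))) 1 := by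
  refine .single ?_
  rw [State.cfg, TM2.step, hM, stepAux_compileOps]
  cases h : p (runOps pre s).reg <;> simp [h, State.cfg]

/-- The compiled program simulates the program step by step. -/
theorem Exec.reachesIn {c : Cmd} {s s' : State} {n : ℕ} (h : Exec c s s' n)
    (M : Λ → TM2.Stmt Stack.Alphabet Λ Reg) (f : c.Label → Λ) (next : Λ)
    (hM : ∀ l, M (f l) = c.stmt f next l) :
    ReachesIn M (s.cfg (some (f c.entry))) (s'.cfg (some next)) n := by
  induction h generalizing next with
  | ops l s => exact reachesIn_compileOps_goto s (hM ())
  | seq _ _ ih₁ ih₂ =>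
    exact (ih₁ _ _ fun l => hM (.inl l)).trans (ih₂ _ _ fun l => hM (.inr l))
  | @ite_true _ _ _ _ s _ _ hp _ ih =>
    have h := reachesIn_compileOps_branch s (hM none)
    rw [hp] at h
    exact h.trans (ih _ _ fun l => hM (some (.inl l)))
  | @ite_false _ _ _ _ s _ _ hp _ ih =>
    have h := reachesIn_compileOps_branch s (hM none)
    rw [hp] at h
    exact h.trans (ih _ _ fun l => hM (some (.inr l)))
  | @loop_exit _ _ _ s hp =>
    have h := reachesIn_compileOps_branch s (hM none)
    rwa [hp] at h
  | @loop_step _ _ _ s _ _ _ _ hp _ _ ih₁ ih₂ =>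
    have h := reachesIn_compileOps_branch s (hM none)
    rw [hp] at h
    -- The body is compiled with the loop's own label as its continuation, so the remaining
    -- iterations satisfy the same hypothesis `hM`.
    exact h.trans ((ih₁ _ _ fun l => hM (some l)).trans (ih₂ _ _ hM))
  | mono _ hnm ih => exact (ih f next hM).mono hnm

end Compile

/-- The machine of a program: the compiled program, followed by a halting statement. -/
def Cmd.machine (c : Cmd) : FinTM2 where
  K := Stack
  k₀ := .input
  k₁ := .output
  Γ := Stack.Alphabet
  Λ := Option c.Label
  main := some c.entry
  ΛFin := @instFintypeOption _ c.labelFintype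
  σ := Reg
  initialState := .ofFlag false
  Γk₀Fin := inferInstanceAs (Fintype (Option Bool))
  m
    | none => .halt
    | some l => c.stmt some none l

/-- The state in which nothing but the input and the output stack may be non-empty. -/
def ioState (i : List (Option Bool)) (o : List Bool) : State :=
  ⟨.ofFlag false, i, o, ⟨[], [], [], [], [], [], [], []⟩⟩

/-- A program which clears all stacks except for the output stack within a polynomial time bound
yields a polynomial time machine. -/
theorem Cmd.computableInPolyTime {α β : Type} {ea : α → List (Option Bool)} {eb : β → List Bool}
    {f : α → β} (c : Cmd) (p : Polynomial ℕ)
    (h : ∀ a, Exec c (ioState (ea a) []) (ioState [] (eb (f a))) (p.eval (ea a).length)) :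
    Nonempty (TM2ComputableInPolyTime ea eb f) := by
  have key (a : α) : Nonempty (TM2OutputsInTime c.machine (ea a) (some (eb (f a)))
      ((p + 1).eval (ea a).length)) := by
    have h₁ := (h a).reachesIn (Λ := Option c.Label) c.machine.m some none fun _ => rfl
    -- The halting statement takes one more step; hence the time bound `p + 1`.
    have h₂ : ReachesIn c.machine.m (State.cfg (some none) (ioState [] (eb (f a))))
        (State.cfg none (ioState [] (eb (f a)))) 1 := .single rfl
    obtain ⟨h₃⟩ := h₁.trans h₂
    have hi : initList c.machine (ea a) = State.cfg (some (some c.entry)) (ioState (ea a) []) := by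
      refine congrArg (TM2.Cfg.mk _ _) (funext fun k => ?_)
      match k with
      | .input => rfl
      | .output => rfl
      | .work w => cases w <;> rfl
    -- `haltList` requires the initial register contents and empty stacks apart from the output, so
    -- programs have to clean up after themselves.
    have ho : haltList c.machine (eb (f a)) = State.cfg none (ioState [] (eb (f a))) := by
      refine congrArg (TM2.Cfg.mk _ _) (funext fun k => ?_)
      match k with
      | .input => rfl
      | .output => rfl
      | .work w => cases w <;> rfl
    refine ⟨⟨⟨h₃.steps, ?_⟩, ?_⟩⟩
    · exact (congrArg (fun s => (flip bind c.machine.step)^[h₃.steps] (some s)) hi).trans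
        (h₃.evals_in_steps.trans (congrArg some ho.symm))
    · simpa using h₃.steps_le_m
  exact ⟨{  tm := c.machine
            inputAlphabet := Equiv.refl _
            outputAlphabet := Equiv.refl _
            time := p + 1
            outputsFun := fun a => by
              have h := (key a).some
              rw [← List.map_id (ea a), ← List.map_id (eb (f a)), List.length_map] at h
              exact h }⟩

end StackProgram

/-! ### The dynamic program: cheapest selections of at least a given value -/

namespace StackProgram

/-! ### Binary numbers and addition -/

/-- The number with the given binary digits, least significant digit first. -/
def bitsVal : List Bool → ℕ
  | [] => 0
  | b :: l => b.toNat + 2 * bitsVal l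

/-- The binary value of a digit; choice digits count as zero. -/
def Digit.val : Digit → Bool
  | choice _ => false
  | bit b => b

/-- The number with the given digits, least significant digit first. -/
def digitsVal : List Digit → ℕ
  | [] => 0
  | d :: l => d.val.toNat + 2 * digitsVal l

theorem digitsVal_map_bit (l : List Bool) : digitsVal (l.map .bit) = bitsVal l := by
  induction l with
  | nil => rfl
  | cons b l ih => simp [digitsVal, bitsVal, ih, Digit.val]

/-- A choice digit is worth zero but occupies a position, so each one in front doubles the value. -/
theorem digitsVal_map_choice_append (c : List Bool) (l : List Digit) :
    digitsVal (c.map .choice ++ l) = 2 ^ c.length * digitsVal l := by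
  induction c with
  | nil => simp
  | cons b c ih => simp [digitsVal, Digit.val, ih, pow_succ]; ring

theorem bitsVal_encodePosNum (n : PosNum) : bitsVal (Computability.encodePosNum n) = n := by
  induction n with
  | one => rfl
  | bit0 n ih => simp [Computability.encodePosNum, bitsVal, ih]; ring
  | bit1 n ih => simp [Computability.encodePosNum, bitsVal, ih]; ring

theorem bitsVal_encodeNat (n : ℕ) : bitsVal (Computability.encodeNat n) = n := by
  have h : ∀ k : Num, bitsVal (Computability.encodeNum k) = k
    | .zero => rfl
    | .pos k => bitsVal_encodePosNum k
  exact (h n).trans (by simp)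

/-- Add a carry bit to a binary number. -/
def incBits : Bool → List Bool → List Bool
  | f, [] => bif f then [true] else []
  | f, y :: ys => (y ^^ f) :: incBits (y && f) ys

/-- Add two binary numbers and a carry bit. -/
def addBits : Bool → List Bool → List Bool → List Bool
  | f, [], ys => incBits f ys
  | f, x :: xs, [] => (x ^^ f) :: addBits (x && f) xs []
  | f, x :: xs, y :: ys => (x ^^ (y ^^ f)) :: addBits (Bool.atLeastTwo x y f) xs ys

theorem bitsVal_incBits (f : Bool) (ys : List Bool) :
    bitsVal (incBits f ys) = f.toNat + bitsVal ys := by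
  induction ys generalizing f with
  | nil => cases f <;> rfl
  | cons y ys ih =>
    cases f <;> cases y <;> simp [incBits, bitsVal, ih]
    ring

theorem bitsVal_addBits (f : Bool) (xs ys : List Bool) :
    bitsVal (addBits f xs ys) = f.toNat + bitsVal xs + bitsVal ys := by
  induction xs generalizing f ys with
  | nil => simp [addBits, bitsVal_incBits, bitsVal]
  | cons x xs ih =>
    cases ys with
    | nil =>
      cases f <;> cases x <;> simp [addBits, bitsVal, ih]
      ring
    | cons y ys =>
      cases f <;> cases x <;> cases y <;> simp [addBits, bitsVal, ih, Bool.atLeastTwo] <;> ring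

theorem length_incBits_le (f : Bool) (ys : List Bool) :
    (incBits f ys).length ≤ ys.length + 1 := by
  induction ys generalizing f with
  | nil => cases f <;> simp [incBits]
  | cons y ys ih => simpa [incBits] using ih _

theorem length_addBits_le (f : Bool) (xs ys : List Bool) :
    (addBits f xs ys).length ≤ xs.length + ys.length + 1 := by
  induction xs generalizing f ys with
  | nil => simpa [addBits] using length_incBits_le f ys
  | cons x xs ih =>
    cases ys with
    | nil => simpa [addBits] using ih _ []
    | cons y ys =>
      have := ih (Bool.atLeastTwo x y f) ys
      simp only [addBits, List.length_cons]
      omega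

/-! ### Table entries and the recurrence -/

/-- A table entry: for every item seen so far, the latest one first, whether it is selected, and the
cost of the selection in binary. -/
abbrev Entry : Type := List Bool × List Bool

/-- The digits of a table entry. -/
def Entry.digits (e : Entry) : List Digit := e.1.map .choice ++ e.2.map .bit

theorem digitsVal_digits (e : Entry) : digitsVal e.digits = 2 ^ e.1.length * bitsVal e.2 := by
  rw [Entry.digits, digitsVal_map_choice_append, digitsVal_map_bit]

/-- With equally many choice digits, both costs are scaled by the same power of two. Whole blocks
can thus be compared without separating choices from cost. -/
theorem digitsVal_digits_le_iff {e e' : Entry} (h : e.1.length = e'.1.length) :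
    digitsVal e.digits ≤ digitsVal e'.digits ↔ bitsVal e.2 ≤ bitsVal e'.2 := by
  rw [digitsVal_digits, digitsVal_digits, h, Nat.mul_le_mul_left_iff (by positivity)]

@[simp] theorem Entry.length_digits (e : Entry) :
    e.digits.length = e.1.length + e.2.length := by simp [Entry.digits]

/-- An item as it is given in the input: its cost in binary and its column of the approval
matrix. -/
abbrev ItemData : Type := List Bool × List Bool

/-- The cost of an item. -/
def ItemData.cost (p : ItemData) : ℕ := bitsVal p.1

/-- The number of voters who approve an item. -/
def ItemData.value (p : ItemData) : ℕ := p.2.count true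

/-- The table in which the latest item is not selected. -/
def rejectTable (T : List Entry) : List Entry := T.map fun e => (false :: e.1, e.2)

/-- The table in which the latest item, of the cost `c`, is selected. -/
def acceptTable (c : List Bool) (T : List Entry) : List Entry :=
  T.map fun e => (true :: e.1, addBits false e.2 c)

/-- Duplicate the first entry of a list. -/
def dupHead {α : Type} : List α → List α
  | [] => []
  | a :: l => a :: a :: l

/-- Duplicate the first entry of a list once for every approval. -/
def shiftTable {α : Type} : List Bool → List α → List α
  | [], U => U
  | b :: col, U => shiftTable col (bif b then dupHead U else U)

/-- The cheaper entries at each position of two tables, of which the second one is longer. -/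
def mergeTables : List Entry → List Entry → List Entry
  | a :: T, u :: U => (if digitsVal a.digits ≤ digitsVal u.digits then a else u) :: mergeTables T U
  | _, U => U

/-- Update the table for one more item. -/
def stepTable (T : List Entry) (p : ItemData) : List Entry :=
  mergeTables (rejectTable T) (shiftTable p.2 (acceptTable p.1 T))

/-- The initial table. -/
def initTable : List Entry := [([], [])]

/-- The last entry of a table which satisfies a predicate. -/
def lastEntry (P : Entry → Prop) [DecidablePred P] (b : Entry) (T : List Entry) : Entry :=
  T.foldl (fun b e => if P e then e else b) b

/-- The digits with which an entry with `k` choice digits is compared in order to find out whether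
its cost is within the limit. -/
def limitDigits (lim : List Bool) (k : ℕ) : List Digit :=
  Entry.digits (List.replicate k false, lim)

/-- The best selection of items, the latest item first. -/
def bestEntry (lim : List Bool) (its : List ItemData) : Entry :=
  lastEntry (fun e => digitsVal e.digits ≤ digitsVal (limitDigits lim its.length)) ([], [])
    (its.foldl stepTable initTable)

theorem shiftTable_cons {α : Type} (col : List Bool) (u : α) (U : List α) :
    shiftTable col (u :: U) = List.replicate (col.count true) u ++ u :: U := by
  induction col generalizing U with
  | nil => rfl
  | cons b col ih =>
    cases b
    · simp [shiftTable, ih]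
    · simp [shiftTable, dupHead, ih, List.replicate_succ']

/-- The copies of the first entry fill exactly the positions at which the truncated subtraction
gives zero. -/
theorem getElem?_shiftTable {α : Type} (col : List Bool) {U : List α} (hU : U ≠ []) (s : ℕ) :
    (shiftTable col U)[s]? = U[s - col.count true]? := by
  obtain ⟨u, U, rfl⟩ := List.exists_cons_of_ne_nil hU
  rw [shiftTable_cons]
  rcases lt_or_ge s (col.count true) with h | h
  · rw [List.getElem?_append_left (by simpa using h), List.getElem?_replicate_of_lt h,
      Nat.sub_eq_zero_of_le h.le]
    rfl
  · rw [List.getElem?_append_right (by simpa using h), List.length_replicate]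

theorem length_shiftTable {α : Type} (col : List Bool) {U : List α} (hU : U ≠ []) :
    (shiftTable col U).length = col.count true + U.length := by
  obtain ⟨u, U, rfl⟩ := List.exists_cons_of_ne_nil hU
  simp [shiftTable_cons]

theorem length_mergeTables {T U : List Entry} (h : T.length ≤ U.length) :
    (mergeTables T U).length = U.length := by
  induction T generalizing U with
  | nil => cases U <;> rfl
  | cons a T ih =>
    cases U with
    | nil => simp at h
    | cons u U => simpa [mergeTables] using ih (by simpa using h)

/-- An entry of a merged table is an entry of the second table which is at most as expensive as the
entry of the first one, or vice versa. -/
theorem getElem?_mergeTables {T U : List Entry} (h : T.length ≤ U.length) {s : ℕ} {e : Entry}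
    (he : (mergeTables T U)[s]? = some e) :
    (T[s]? = some e ∧ ∀ u, U[s]? = some u → digitsVal e.digits ≤ digitsVal u.digits) ∨
      (U[s]? = some e ∧ ∀ a, T[s]? = some a → digitsVal e.digits ≤ digitsVal a.digits) := by
  induction T generalizing U s with
  | nil =>
    right
    cases U with
    | nil => simp [mergeTables] at he
    | cons u U => simpa [mergeTables] using he
  | cons a T ih =>
    cases U with
    | nil => simp at h
    | cons u U =>
      cases s with
      | zero =>
        simp only [mergeTables, List.getElem?_cons_zero, Option.some.injEq] at he
        split_ifs at he with hle <;> subst he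
        · exact .inl ⟨rfl, by simpa using hle⟩
        · exact .inr ⟨rfl, by simpa using (not_le.1 hle).le⟩
      | succ s => exact ih (by simpa using h) (by simpa [mergeTables] using he)

/-! ### Optimality of the tables -/

/-- The total weight of the selected items. -/
def selectedSum (w : ItemData → ℕ) (ps : List ItemData) (bs : List Bool) : ℕ :=
  (List.zipWith (fun p b => bif b then w p else 0) ps bs).sum

theorem selectedSum_cons (w : ItemData → ℕ) (p : ItemData) (ps : List ItemData) (b : Bool)
    (bs : List Bool) :
    selectedSum w (p :: ps) (b :: bs) = (bif b then w p else 0) + selectedSum w ps bs := by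
  simp [selectedSum]

theorem selectedSum_reverse (w : ItemData → ℕ) {ps : List ItemData} {bs : List Bool}
    (h : ps.length = bs.length) :
    selectedSum w ps.reverse bs.reverse = selectedSum w ps bs := by
  rw [selectedSum, ← List.reverse_zipWith h, List.sum_reverse, selectedSum]

theorem selectedSum_le (w : ItemData → ℕ) (ps : List ItemData) (bs : List Bool) :
    selectedSum w ps bs ≤ (ps.map w).sum := by
  induction ps generalizing bs with
  | nil => simp [selectedSum]
  | cons p ps ih =>
    cases bs with
    | nil => simp [selectedSum]
    | cons b bs =>
      rw [selectedSum_cons, List.map_cons, List.sum_cons]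
      exact Nat.add_le_add (by cases b <;> simp) (ih bs)

/-- The entry `e` describes a cheapest selection among the selections of value at least `s`. -/
structure IsCheapest (ps : List ItemData) (s : ℕ) (e : Entry) : Prop where
  length_eq : e.1.length = ps.length
  cost_eq : bitsVal e.2 = selectedSum ItemData.cost ps e.1
  le_value : s ≤ selectedSum ItemData.value ps e.1
  cost_le : ∀ bs : List Bool, bs.length = ps.length → s ≤ selectedSum ItemData.value ps bs →
    bitsVal e.2 ≤ selectedSum ItemData.cost ps bs

/-- The entry at each position `s` of the table describes a cheapest selection of value at
least `s`. -/
structure IsOptimalTable (ps : List ItemData) (T : List Entry) : Prop where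
  length_eq : T.length = (ps.map ItemData.value).sum + 1
  cheapest : ∀ s e, T[s]? = some e → IsCheapest ps s e

theorem isOptimalTable_initTable : IsOptimalTable [] initTable where
  length_eq := rfl
  cheapest s e h := by
    cases s with
    | zero =>
      obtain rfl : ([], []) = e := by simpa [initTable] using h
      exact ⟨rfl, rfl, le_rfl, fun _ _ _ => Nat.zero_le _⟩
    | succ s => simp [initTable] at h

/-- A competitor of value at least `s` either rejects `p`, and its tail competes with the old entry
at `s`, or accepts `p`, and its tail competes with the old entry at `s - p.value`. The merged entry
is at most as expensive as both extensions. -/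
theorem IsOptimalTable.step {ps : List ItemData} {T : List Entry} (h : IsOptimalTable ps T)
    (p : ItemData) : IsOptimalTable (p :: ps) (stepTable T p) := by
  have hT : T ≠ [] := by
    rintro rfl
    simpa using h.length_eq
  have hacc : acceptTable p.1 T ≠ [] := by simpa [acceptTable] using hT
  have hlen : (shiftTable p.2 (acceptTable p.1 T)).length = p.value + T.length := by
    rw [length_shiftTable _ hacc, acceptTable, List.length_map]
    rfl
  have hle : (rejectTable T).length ≤ (shiftTable p.2 (acceptTable p.1 T)).length := by
    rw [hlen, rejectTable, List.length_map]
    exact Nat.le_add_left _ _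
  have hrej (s : ℕ) : (rejectTable T)[s]? = T[s]?.map fun e => (false :: e.1, e.2) := by
    simp [rejectTable]
  have hshift (s : ℕ) : (shiftTable p.2 (acceptTable p.1 T))[s]? =
      T[s - p.value]?.map fun e => (true :: e.1, addBits false e.2 p.1) := by
    rw [getElem?_shiftTable _ hacc]
    simp [acceptTable, ItemData.value]
  have hget {s : ℕ} (hs : s ≤ (ps.map ItemData.value).sum) : ∃ e, T[s]? = some e :=
    ⟨_, List.getElem?_eq_getElem (by rw [h.length_eq]; omega)⟩
  refine ⟨?_, fun s e he => ?_⟩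
  · rw [stepTable, length_mergeTables hle, hlen, h.length_eq, List.map_cons, List.sum_cons]
    ring
  · have hcases := getElem?_mergeTables hle he
    rw [hrej, hshift] at hcases
    -- This lower bound does not depend on which table `e` comes from. The number of choices in `e`
    -- enters because comparing digits means comparing costs only for equally many choice digits.
    have hbound : ∀ bs : List Bool, bs.length = (p :: ps).length →
        s ≤ selectedSum ItemData.value (p :: ps) bs →
        e.1.length = (p :: ps).length →
        bitsVal e.2 ≤ selectedSum ItemData.cost (p :: ps) bs := by
      intro bs hbs hval hel
      cases bs with
      | nil => simp at hbs
      | cons b bs =>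
        rw [selectedSum_cons] at hval ⊢
        have hbs' : bs.length = ps.length := by simpa using hbs
        have hsum := selectedSum_le ItemData.value ps bs
        cases b
        · simp only [cond_false, zero_add] at hval ⊢
          obtain ⟨a, ha⟩ := hget (hval.trans hsum)
          have hopt := h.cheapest s a ha
          refine le_trans ?_ (hopt.cost_le bs hbs' hval)
          rcases hcases with ⟨h₁, -⟩ | ⟨-, h₂⟩
          · rw [ha, Option.map_some, Option.some.injEq] at h₁
            subst h₁
            exact le_rfl
          · have := h₂ _ (by rw [ha]; rfl)
            rwa [digitsVal_digits_le_iff (by simp [hel, hopt.length_eq])] at this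
        · simp only [cond_true] at hval ⊢
          have hval' : s - p.value ≤ selectedSum ItemData.value ps bs := by omega
          obtain ⟨a, ha⟩ := hget (hval'.trans hsum)
          have hopt := h.cheapest _ a ha
          have hadd : bitsVal (addBits false a.2 p.1) ≤
              p.cost + selectedSum ItemData.cost ps bs := by
            rw [bitsVal_addBits, Bool.toNat_false, zero_add, add_comm]
            exact Nat.add_le_add_left (hopt.cost_le bs hbs' hval') _
          refine le_trans ?_ hadd
          rcases hcases with ⟨-, h₁⟩ | ⟨h₂, -⟩
          · have := h₁ _ (by rw [ha]; rfl)
            rwa [digitsVal_digits_le_iff (by simp [hel, hopt.length_eq])] at this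
          · rw [ha, Option.map_some, Option.some.injEq] at h₂
            subst h₂
            exact le_rfl
    rcases hcases with ⟨h₁, -⟩ | ⟨h₂, -⟩
    · obtain ⟨a, ha, rfl⟩ := Option.map_eq_some_iff.1 h₁
      have hopt := h.cheapest _ a ha
      have hel : (false :: a.1).length = (p :: ps).length := by simp [hopt.length_eq]
      refine ⟨hel, ?_, ?_, fun bs hbs hval => hbound bs hbs hval hel⟩
      · simpa [selectedSum_cons] using hopt.cost_eq
      · simpa [selectedSum_cons] using hopt.le_value
    · obtain ⟨a, ha, rfl⟩ := Option.map_eq_some_iff.1 h₂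
      have hopt := h.cheapest _ a ha
      have hel : (true :: a.1).length = (p :: ps).length := by simp [hopt.length_eq]
      refine ⟨hel, ?_, ?_, fun bs hbs hval => hbound bs hbs hval hel⟩
      · rw [bitsVal_addBits, hopt.cost_eq, selectedSum_cons, Bool.toNat_false, zero_add, add_comm]
        rfl
      · have := hopt.le_value
        rw [selectedSum_cons, cond_true]
        omega

theorem isOptimalTable_foldl {ps : List ItemData} {T : List Entry} (h : IsOptimalTable ps T)
    (its : List ItemData) : IsOptimalTable (its.reverse ++ ps) (its.foldl stepTable T) := by
  induction its generalizing ps T with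
  | nil => simpa using h
  | cons p its ih => simpa using ih (h.step p)

/-- The fold overwrites its result at each success, so the final result has the largest successful
position. Costs need not be monotone along the table, and `b` survives only if no entry succeeds. -/
theorem lastEntry_spec (P : Entry → Prop) [DecidablePred P] (b : Entry) (T : List Entry) :
    (∀ e ∈ T, ¬ P e) ∨ ∃ s, T[s]? = some (lastEntry P b T) ∧ P (lastEntry P b T) ∧
      ∀ (s' : ℕ) (e : Entry), T[s']? = some e → P e → s' ≤ s := by
  induction T using List.reverseRecOn with
  | nil => simp
  | append_singleton T e ih =>
    have heq : lastEntry P b (T ++ [e]) = if P e then e else lastEntry P b T := by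
      simp [lastEntry]
    rw [heq]
    by_cases he : P e
    · refine .inr ⟨T.length, ?_⟩
      rw [if_pos he]
      refine ⟨by simp, he, fun s' e' h _ => ?_⟩
      have := (List.getElem?_eq_some_iff.1 h).1
      simp at this
      omega
    · rw [if_neg he]
      have hlast {s' : ℕ} {e' : Entry} (h : (T ++ [e])[s']? = some e') (h' : P e') :
          T[s']? = some e' := by
        rcases lt_or_ge s' T.length with hs | hs
        · rwa [List.getElem?_append_left hs] at h
        · rw [List.getElem?_append_right hs] at h
          have := List.mem_of_getElem? h
          simp only [List.mem_singleton] at this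
          exact absurd (this ▸ h') he
      rcases ih with ih | ⟨s, h₁, h₂, h₃⟩
      · left
        intro e' he'
        rcases List.mem_append.1 he' with h | h
        · exact ih e' h
        · rwa [List.mem_singleton.1 h]
      · refine .inr ⟨s, ?_, h₂, fun s' e' h h' => h₃ s' e' (hlast h h') h'⟩
        rwa [List.getElem?_append_left (List.getElem?_eq_some_iff.1 h₁).1]

/-- The best entry describes a selection within the limit whose value is maximal. -/
theorem bestEntry_spec (lim : List Bool) (its : List ItemData) :
    (bestEntry lim its).1.length = its.length ∧
    selectedSum ItemData.cost its (bestEntry lim its).1.reverse ≤ bitsVal lim ∧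
    ∀ bs : List Bool, bs.length = its.length →
      selectedSum ItemData.cost its bs ≤ bitsVal lim →
      selectedSum ItemData.value its bs ≤
        selectedSum ItemData.value its (bestEntry lim its).1.reverse := by
  have hopt := isOptimalTable_foldl isOptimalTable_initTable its
  rw [List.append_nil] at hopt
  -- The value of a feasible selection is a position of the table, and the entry there costs no more
  -- than that selection.
  have hfind (bs : List Bool) (hbs : bs.length = its.length)
      (hcost : selectedSum ItemData.cost its bs ≤ bitsVal lim) :
      ∃ e, (its.foldl stepTable initTable)[selectedSum ItemData.value its bs]? = some e ∧
        digitsVal e.digits ≤ digitsVal (limitDigits lim its.length) := by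
    have hs : selectedSum ItemData.value its bs < (its.foldl stepTable initTable).length := by
      rw [hopt.length_eq, List.map_reverse, List.sum_reverse]
      exact Nat.lt_succ_of_le (selectedSum_le ..)
    refine ⟨_, List.getElem?_eq_getElem hs, ?_⟩
    have hch := hopt.cheapest _ _ (List.getElem?_eq_getElem hs)
    rw [limitDigits, digitsVal_digits_le_iff (by simp [hch.length_eq])]
    refine (hch.cost_le bs.reverse (by simp [hbs]) ?_).trans ?_
    · rw [selectedSum_reverse _ hbs.symm]
    · rwa [selectedSum_reverse _ hbs.symm]
  rcases lastEntry_spec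
    (fun e => digitsVal e.digits ≤ digitsVal (limitDigits lim its.length)) ([], [])
    (its.foldl stepTable initTable) with hno | ⟨s, hs, hle, hmax⟩
  -- The empty selection is feasible, so some entry is affordable and the default is never returned.
  · obtain ⟨e, he, he'⟩ := hfind (List.replicate its.length false) (by simp) (by
      have : ∀ ps : List ItemData,
          selectedSum ItemData.cost ps (List.replicate ps.length false) = 0 := by
        intro ps
        induction ps with
        | nil => rfl
        | cons p ps ih => simpa [List.replicate_succ, selectedSum_cons] using ih
      rw [this]
      exact Nat.zero_le _)
    exact absurd he' (hno e (List.mem_of_getElem? he))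
  · change _ = some (bestEntry lim its) at hs
    have hch := hopt.cheapest _ _ hs
    have hlen : (bestEntry lim its).1.length = its.length := by simpa using hch.length_eq
    have hrev (w : ItemData → ℕ) : selectedSum w its (bestEntry lim its).1.reverse =
        selectedSum w its.reverse (bestEntry lim its).1 := by
      rw [← selectedSum_reverse w (bs := (bestEntry lim its).1.reverse) (by simp [hlen]),
        List.reverse_reverse]
    refine ⟨hlen, ?_, fun bs hbs hcost => ?_⟩
    · change digitsVal (bestEntry lim its).digits ≤ _ at hle
      rw [hrev, ← hch.cost_eq]
      rwa [limitDigits, digitsVal_digits_le_iff (by simp [hch.length_eq])] at hle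
    · obtain ⟨e, he, he'⟩ := hfind bs hbs hcost
      rw [hrev]
      -- The value of `bs` is an affordable position, hence at most the last one, `s`, and the entry
      -- at `s` has value at least `s`.
      exact (hmax _ _ he he').trans hch.le_value

end StackProgram

/-! ### Programs for blocks of symbols -/

namespace StackProgram

/-- Is the symbol on top of a stack a digit? -/
def isDigit (a : Option Sym) : Bool := a.join.isSome

/-- Is the symbol on top of a stack a choice digit? -/
def isChoice : Option Sym → Bool
  | some (some (.choice _)) => true
  | _ => false

/-- The binary value of the symbol on top of a stack, zero if there is no bit. -/
def bitOf : Option Sym → Bool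
  | some (some d) => d.val
  | _ => false

/-- The bit of the symbol on top of a stack, if it is a choice digit. -/
def choiceOf : Option Sym → Bool
  | some (some (.choice b)) => b
  | _ => false

/-- Pop a symbol into the first register. -/
abbrev popX (w : Work) : Op := .pop (fun _ => true) w fun r a => { r with x := a }

/-- Read the top symbol into the first register. -/
abbrev peekX (w : Work) : Op := .peek w fun r a => { r with x := a }

/-- Read the top symbol into the second register. -/
abbrev peekY (w : Work) : Op := .peek w fun r a => { r with y := a }

/-- Pop a symbol and forget it. -/
abbrev dropTop (w : Work) : Op := .pop (fun _ => true) w fun r _ => r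

/-- Push the symbol in the first register. -/
abbrev pushX (w : Work) : Op := .push (fun _ => true) w fun r => r.x.join

/-- Push the given symbol. -/
abbrev pushSym (w : Work) (a : Sym) : Op := .push (fun _ => true) w fun _ => a

/-- Empty the registers, but keep the flag. -/
abbrev clearReg : Op := .load fun r => .ofFlag r.flag

/-- Empty the registers and set the flag. -/
abbrev setFlag (b : Bool) : Op := .load fun _ => .ofFlag b

/-- Pop an input symbol into its register. -/
abbrev popI : Op := .popInput fun r a => { r with i := a }

/-- A block of symbols with its end marker. -/
def block (l : List Digit) : List Sym := l.map some ++ [none]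

@[simp] theorem length_block (l : List Digit) : (block l).length = l.length + 1 := by simp [block]

/-- Move a whole stack onto another one. -/
def pour (a b : Work) : Cmd := .loop [popX a] (fun r => r.x.isSome) (.ops [pushX b, clearReg])

/-- Each symbol costs one test, which pops it, and one run of the body; the failing test on the
empty stack adds one step. -/
theorem exec_pour {a b : Work} (hab : a ≠ b) (f i o m) :
    Exec (pour a b) ⟨.ofFlag f, i, o, m⟩
      ⟨.ofFlag f, i, o, (m.set a []).set b ((m.get a).reverse ++ m.get b)⟩
      (2 * (m.get a).length + 1) := by
  generalize hl : m.get a = l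
  induction l generalizing m with
  | nil =>
    refine (Exec.loop_exit (by simp [Op.run, hl])).cast ?_ le_rfl
    simp only [runOps_cons, runOps_nil, Op.run, hl, cond_true, State.mk.injEq, true_and]
    refine ⟨rfl, Mem.ext_get fun w => ?_⟩
    simp only [Mem.get_set]
    split_ifs <;> simp_all
  | cons x l ih =>
    refine Exec.cast (Exec.loop_step (by simp [Op.run, hl])
      ((Exec.ops _ _).cast (s₂ := ⟨.ofFlag f, i, o, (m.set a l).set b (x :: m.get b)⟩) ?_ le_rfl)
      (ih _ ?_)) ?_ ?_
    · simp [Op.run, hl, Mem.get_set, hab.symm]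
    · simp [Mem.get_set, hab]
    · simp only [State.mk.injEq, true_and]
      refine Mem.ext_get fun w => ?_
      simp only [Mem.get_set]
      split_ifs <;> simp_all
    · simp only [List.length_cons]
      omega

/-- Empty a stack. -/
def clear (a : Work) : Cmd := .loop [popX a] (fun r => r.x.isSome) (.ops [clearReg])

theorem exec_clear (a : Work) (f i o m) :
    Exec (clear a) ⟨.ofFlag f, i, o, m⟩ ⟨.ofFlag f, i, o, m.set a []⟩
      (2 * (m.get a).length + 1) := by
  generalize hl : m.get a = l
  induction l generalizing m with
  | nil =>
    refine (Exec.loop_exit (by simp [Op.run, hl])).cast ?_ le_rfl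
    simp [Op.run, hl]
  | cons x l ih =>
    refine Exec.cast (Exec.loop_step (by simp [Op.run, hl])
      ((Exec.ops _ _).cast (s₂ := ⟨.ofFlag f, i, o, m.set a l⟩) ?_ le_rfl)
      (ih _ ?_)) ?_ ?_
    · simp [Op.run, hl]
    · simp [Mem.get_set]
    · simp only [State.mk.injEq, true_and]
      refine Mem.ext_get fun w => ?_
      simp only [Mem.get_set]
      split_ifs <;> rfl
    · simp only [List.length_cons]
      omega

/-- Remove the top block of a stack. -/
def dropBlock (a : Work) : Cmd :=
  .seq (.loop [popX a] (fun r => isDigit r.x) (.ops [clearReg])) (.ops [clearReg])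

theorem exec_dropBlock {a : Work} (f i o m) {l : List Digit} {t : List Sym}
    (hl : m.get a = block l ++ t) :
    Exec (dropBlock a) ⟨.ofFlag f, i, o, m⟩ ⟨.ofFlag f, i, o, m.set a t⟩
      (2 * l.length + 2) := by
  -- The loop leaves the popped end marker in the register `x`, which the last operation clears.
  suffices h : Exec (.loop [popX a] (fun r => isDigit r.x) (.ops [clearReg]))
      ⟨.ofFlag f, i, o, m⟩ ⟨⟨some none, none, none, f⟩, i, o, m.set a t⟩ (2 * l.length + 1) from
    (h.seq (.ops _ _)).cast rfl (by omega)
  induction l generalizing m with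
  | nil =>
    replace hl : m.get a = none :: t := hl
    refine (Exec.loop_exit (by simp [Op.run, hl, isDigit])).cast ?_ le_rfl
    simp [Op.run, hl]
  | cons x l ih =>
    replace hl : m.get a = some x :: (block l ++ t) := hl
    refine Exec.cast (Exec.loop_step (by simp [Op.run, hl, isDigit])
      ((Exec.ops _ _).cast (s₂ := ⟨.ofFlag f, i, o, m.set a (block l ++ t)⟩) ?_ le_rfl)
      (ih _ ?_)) ?_ ?_
    · simp [Op.run, hl]
    · simp [Mem.get_set]
    · simp only [State.mk.injEq, true_and]
      refine Mem.ext_get fun w => ?_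
      simp only [Mem.get_set]
      split_ifs <;> rfl
    · simp only [List.length_cons]
      omega

/-- Move the top block of a stack onto another one. -/
def moveBlock (a b : Work) : Cmd :=
  .seq (.loop [popX a] (fun r => isDigit r.x) (.ops [pushX b, clearReg]))
    (.ops [pushSym b none, clearReg])

theorem exec_moveBlock {a b : Work} (hab : a ≠ b) (f i o m) {l : List Digit} {t : List Sym}
    (hl : m.get a = block l ++ t) :
    Exec (moveBlock a b) ⟨.ofFlag f, i, o, m⟩
      ⟨.ofFlag f, i, o, (m.set a t).set b ((block l).reverse ++ m.get b)⟩ (2 * l.length + 2) := by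
  suffices h : Exec (.loop [popX a] (fun r => isDigit r.x) (.ops [pushX b, clearReg]))
      ⟨.ofFlag f, i, o, m⟩ ⟨⟨some none, none, none, f⟩, i, o,
        (m.set a t).set b ((l.map some).reverse ++ m.get b)⟩ (2 * l.length + 1) by
    refine (h.seq (.ops _ _)).cast ?_ (by omega)
    simp only [runOps_cons, runOps_nil, Op.run, cond_true, State.mk.injEq, true_and]
    refine Mem.ext_get fun w => ?_
    simp only [Mem.get_set]
    split_ifs <;> simp_all [block]
  induction l generalizing m with
  | nil =>
    replace hl : m.get a = none :: t := hl
    refine (Exec.loop_exit (by simp [Op.run, hl, isDigit])).cast ?_ le_rfl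
    simp only [runOps_cons, runOps_nil, Op.run, cond_true, State.mk.injEq, hl, true_and]
    refine ⟨rfl, Mem.ext_get fun w => ?_⟩
    simp only [Mem.get_set]
    split_ifs <;> simp_all
  | cons x l ih =>
    replace hl : m.get a = some x :: (block l ++ t) := hl
    refine Exec.cast (Exec.loop_step (by simp [Op.run, hl, isDigit])
      ((Exec.ops _ _).cast
        (s₂ := ⟨.ofFlag f, i, o, (m.set a (block l ++ t)).set b (some x :: m.get b)⟩) ?_ le_rfl)
      (ih _ ?_)) ?_ ?_
    · simp [Op.run, hl, Mem.get_set, hab.symm]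
    · simp [Mem.get_set, hab]
    · simp only [State.mk.injEq, true_and]
      refine Mem.ext_get fun w => ?_
      simp only [Mem.get_set]
      split_ifs <;> simp_all
    · simp only [List.length_cons]
      omega

/-- Duplicate the top block of the stack `U`. -/
def dupBlock : Cmd :=
  .seq (.loop [popX .U] (fun r => isDigit r.x) (.ops [pushX .A, pushX .B, clearReg]))
    (.seq (.ops [pushSym .U none, clearReg]) (.seq (pour .A .U)
      (.seq (.ops [pushSym .U none]) (pour .B .U))))

/-- Popping reverses the digits into two buffers, and pouring a buffer back restores their order.
The buffers hold no end marker, so one is pushed before each copy. -/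
theorem exec_dupBlock (f i o) (t u r s c l : List Sym) (w : List Digit) :
    Exec dupBlock ⟨.ofFlag f, i, o, ⟨t, block w ++ u, r, s, [], [], c, l⟩⟩
      ⟨.ofFlag f, i, o, ⟨t, block w ++ (block w ++ u), r, s, [], [], c, l⟩⟩
      (6 * w.length + 5) := by
  have h (a b : List Sym) : Exec (.loop [popX .U] (fun r => isDigit r.x)
      (.ops [pushX .A, pushX .B, clearReg]))
      ⟨.ofFlag f, i, o, ⟨t, block w ++ u, r, s, a, b, c, l⟩⟩
      ⟨⟨some none, none, none, f⟩, i, o,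
        ⟨t, u, r, s, (w.map some).reverse ++ a, (w.map some).reverse ++ b, c, l⟩⟩
      (2 * w.length + 1) := by
    induction w generalizing a b with
    | nil => exact Exec.loop_exit rfl
    | cons x w ih =>
      refine (Exec.loop_step rfl (.ops _ _) (ih (some x :: a) (some x :: b))).cast ?_ ?_
      · simp
      · simp only [List.length_cons]
        omega
  refine ((h [] []).seq (.seq (.ops _ _) (.seq (exec_pour (by decide) _ _ _ _)
    (.seq (.ops _ _) (exec_pour (by decide) _ _ _ _))))).cast ?_ ?_
  · simp [Op.run, Mem.get, Mem.set, block]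
  · simp [Op.run, Mem.get, Mem.set]
    omega

/-- Compare the numbers in the top blocks of the stack `T` and the stack `b`. -/
def compareBlocks (b : Work) : Cmd :=
  .seq (.loop [peekX .T, peekY b] (fun r => isDigit r.x || isDigit r.y)
    (.ops [.pop (fun r => isDigit r.x) .T fun r _ => r, .push (fun r => isDigit r.x) .A (·.x.join),
      .pop (fun r => isDigit r.y) b fun r _ => r, .push (fun r => isDigit r.y) .B (·.y.join),
      .load fun r => .ofFlag (bif bitOf r.x == bitOf r.y then r.flag else bitOf r.y)]))
    (.seq (.ops [clearReg]) (.seq (pour .A .T) (pour .B b)))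

/-- Digits arrive least significant first, so a later difference overrides the earlier verdict in
the flag. An end marker is only peeked at and counts as zero, which handles different lengths; the
digits saved on `A` and `B` restore both stacks. -/
theorem exec_compareBlocks {b : Work} (hT : b ≠ .T) (hA : b ≠ .A) (hB : b ≠ .B) (i o m)
    {xs ys : List Digit} {t u : List Sym} (hx : m.get .T = block xs ++ t)
    (hy : m.get b = block ys ++ u) (hmA : m.get .A = []) (hmB : m.get .B = []) :
    Exec (compareBlocks b) ⟨.ofFlag true, i, o, m⟩
      ⟨.ofFlag (decide (digitsVal xs ≤ digitsVal ys)), i, o, m⟩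
      (4 * (xs.length + ys.length) + 4) := by
  -- Generalized over the incoming flag: true asks for `≤` on the remaining digits, false for `<`.
  -- Both are expressed by `xs < ys + f`.
  have h : ∀ (xs ys : List Digit) (f : Bool) (m : Mem), m.get .T = block xs ++ t →
      m.get b = block ys ++ u →
      Exec (.loop [peekX .T, peekY b] (fun r => isDigit r.x || isDigit r.y)
        (.ops [.pop (fun r => isDigit r.x) .T fun r _ => r,
          .push (fun r => isDigit r.x) .A (·.x.join),
          .pop (fun r => isDigit r.y) b fun r _ => r, .push (fun r => isDigit r.y) .B (·.y.join),
          .load fun r => .ofFlag (bif bitOf r.x == bitOf r.y then r.flag else bitOf r.y)]))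
        ⟨.ofFlag f, i, o, m⟩
        ⟨⟨some none, some none, none, decide (digitsVal xs < digitsVal ys + f.toNat)⟩, i, o,
          (((m.set .T (none :: t)).set b (none :: u)).set .A
            ((xs.map some).reverse ++ m.get .A)).set .B ((ys.map some).reverse ++ m.get .B)⟩
        (2 * (xs.length + ys.length) + 1) := by
    intro xs
    induction xs with
    | nil =>
      intro ys
      induction ys with
      | nil =>
        intro f m hx hy
        replace hx : m.get .T = none :: t := hx
        replace hy : m.get b = none :: u := hy
        refine (Exec.loop_exit (by simp [Op.run, hx, hy, isDigit])).cast ?_ (by simp)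
        simp only [runOps_cons, runOps_nil, Op.run, State.mk.injEq, hx, hy, true_and]
        refine ⟨by cases f <;> rfl, Mem.ext_get fun w => ?_⟩
        simp only [Mem.get_set]
        split_ifs <;> simp_all
      | cons y ys ih =>
        intro f m hx hy
        replace hx : m.get .T = none :: t := hx
        replace hy : m.get b = some y :: (block ys ++ u) := hy
        refine Exec.cast (Exec.loop_step (by simp [Op.run, hx, hy, isDigit])
          ((Exec.ops _ _).cast (s₂ := ⟨.ofFlag (bif false == y.val then f else y.val), i, o,
            (m.set b (block ys ++ u)).set .B (some y :: m.get .B)⟩) ?_ le_rfl)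
          (ih _ _ ?_ ?_)) ?_ ?_
        · simp [Op.run, hx, hy, isDigit, bitOf, Mem.get_set, hB.symm]
        · simp [Mem.get_set, hT.symm, hx, block]
        · simp [Mem.get_set, hB]
        · simp only [State.mk.injEq, true_and]
          refine ⟨?_, Mem.ext_get fun w => ?_⟩
          · cases f <;> cases hv : y.val <;> simp [digitsVal, hv]
          · simp only [Mem.get_set]
            split_ifs <;> simp_all
        · simp only [List.length_cons]
          omega
    | cons x xs ih =>
      intro ys f m hx hy
      replace hx : m.get .T = some x :: (block xs ++ t) := hx
      cases ys with
      | nil =>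
        replace hy : m.get b = none :: u := hy
        refine Exec.cast (Exec.loop_step (by simp [Op.run, hx, hy, isDigit])
          ((Exec.ops _ _).cast (s₂ := ⟨.ofFlag (bif x.val == false then f else false), i, o,
            (m.set .T (block xs ++ t)).set .A (some x :: m.get .A)⟩) ?_ le_rfl)
          (ih [] _ _ ?_ ?_)) ?_ ?_
        · simp [Op.run, hx, hy, isDigit, bitOf, Mem.get_set]
        · simp [Mem.get_set]
        · simp [Mem.get_set, hT, hA, hy, block]
        · simp only [State.mk.injEq, true_and]
          refine ⟨?_, Mem.ext_get fun w => ?_⟩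
          · cases f <;> cases hv : x.val <;> simp [digitsVal, hv]
          · simp only [Mem.get_set]
            split_ifs <;> simp_all
        · simp only [List.length_cons]
          omega
      | cons y ys =>
        replace hy : m.get b = some y :: (block ys ++ u) := hy
        refine Exec.cast (Exec.loop_step (by simp [Op.run, hx, hy, isDigit])
          ((Exec.ops _ _).cast (s₂ := ⟨.ofFlag (bif x.val == y.val then f else y.val), i, o,
            (((m.set .T (block xs ++ t)).set .A (some x :: m.get .A)).set b
              (block ys ++ u)).set .B (some y :: m.get .B)⟩) ?_ le_rfl)
          (ih ys _ _ ?_ ?_)) ?_ ?_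
        · simp [Op.run, hx, hy, isDigit, bitOf, Mem.get_set, hT, hA, hB.symm]
        · simp [Mem.get_set, hT.symm]
        · simp [Mem.get_set, hB]
        · simp only [State.mk.injEq, true_and]
          refine ⟨?_, Mem.ext_get fun w => ?_⟩
          · cases f <;> cases hv : x.val <;> cases hw : y.val <;>
              simp [digitsVal, hv, hw] <;> omega
          · simp only [Mem.get_set]
            split_ifs <;> simp_all
        · simp only [List.length_cons]
          omega
  refine ((h xs ys true m hx hy).seq (.seq (.ops _ _) (.seq (exec_pour (by decide) _ _ _ _)
    (exec_pour hB.symm _ _ _ _)))).cast ?_ ?_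
  · simp only [State.mk.injEq, true_and]
    refine ⟨by simp, Mem.ext_get fun w => ?_⟩
    simp only [Mem.get_set]
    split_ifs <;> simp_all [block]
  · simp [Mem.get_set, hmA, hmB]
    omega

/-- Read a block of the input: move its bits onto a stack. -/
def readBlock (w : Work) : Cmd :=
  .seq (.loop [popI] (fun r => r.i.join.isSome)
    (.ops [.push (fun _ => true) .A fun r => r.i.join.map .bit, clearReg]))
    (.seq (.ops [clearReg]) (pour .A w))

/-- A block of the input. -/
def inputBlock (l : List Bool) : List (Option Bool) := l.map some ++ [none]

@[simp] theorem length_inputBlock (l : List Bool) : (inputBlock l).length = l.length + 1 := by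
  simp [inputBlock]

theorem exec_readBlock {w : Work} (hw : w ≠ .A) (f i o m) (l : List Bool)
    (hm : m.get .A = []) :
    Exec (readBlock w) ⟨.ofFlag f, inputBlock l ++ i, o, m⟩
      ⟨.ofFlag f, i, o, m.set w (l.map (fun b => some (.bit b)) ++ m.get w)⟩
      (4 * l.length + 3) := by
  have h (m : Mem) : Exec (.loop [popI] (fun r => r.i.join.isSome)
      (.ops [.push (fun _ => true) .A fun r => r.i.join.map .bit, clearReg]))
      ⟨.ofFlag f, inputBlock l ++ i, o, m⟩
      ⟨⟨none, none, some none, f⟩, i, o,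
        m.set .A ((l.map fun b => some (.bit b)).reverse ++ m.get .A)⟩ (2 * l.length + 1) := by
    induction l generalizing m with
    | nil => exact Exec.loop_exit rfl
    | cons x l ih =>
      refine (Exec.loop_step rfl (.ops _ _) (ih (m.set .A (some (.bit x) :: m.get .A)))).cast ?_ ?_
      · simp only [State.mk.injEq, true_and]
        refine Mem.ext_get fun w => ?_
        simp only [Mem.get_set]
        split_ifs <;> simp_all
      · simp only [List.length_cons]
        omega
  refine ((h m).seq (.seq (.ops _ _) (exec_pour hw.symm _ _ _ _))).cast ?_ ?_
  · simp only [State.mk.injEq, true_and]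
    refine Mem.ext_get fun w => ?_
    simp only [Mem.get_set]
    split_ifs <;> simp_all
  · simp [Mem.get_set, hm]
    omega

/-- Skip a block of the input. -/
def skipBlock : Cmd :=
  .seq (.loop [popI] (fun r => r.i.join.isSome) (.ops [clearReg])) (.ops [clearReg])

theorem exec_skipBlock (f i o m) (l : List Bool) :
    Exec skipBlock ⟨.ofFlag f, inputBlock l ++ i, o, m⟩ ⟨.ofFlag f, i, o, m⟩
      (2 * l.length + 2) := by
  suffices h : Exec (.loop [popI] (fun r => r.i.join.isSome) (.ops [clearReg]))
      ⟨.ofFlag f, inputBlock l ++ i, o, m⟩ ⟨⟨none, none, some none, f⟩, i, o, m⟩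
      (2 * l.length + 1) from (h.seq (.ops _ _)).cast rfl (by omega)
  induction l with
  | nil => exact Exec.loop_exit rfl
  | cons x l ih =>
    refine (Exec.loop_step rfl (.ops _ _) ih).cast rfl ?_
    simp only [List.length_cons]
    omega

end StackProgram

/-! ### The program -/

namespace StackProgram

/-- The symbols of a table. -/
def tableSyms (T : List Entry) : List Sym := T.flatMap fun e => block e.digits

@[simp] theorem tableSyms_nil : tableSyms [] = [] := rfl

@[simp] theorem tableSyms_cons (e : Entry) (T : List Entry) :
    tableSyms (e :: T) = block e.digits ++ tableSyms T := rfl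

@[simp] theorem tableSyms_append (T U : List Entry) :
    tableSyms (T ++ U) = tableSyms T ++ tableSyms U := List.flatMap_append

/-! ### Size of the tables -/

/-- All entries of a table have at most `N` digits. -/
def DigitsLE (N : ℕ) (T : List Entry) : Prop := ∀ e ∈ T, e.digits.length ≤ N

theorem DigitsLE.mono {N M : ℕ} {T : List Entry} (h : DigitsLE N T) (hNM : N ≤ M) :
    DigitsLE M T := fun e he => (h e he).trans hNM

theorem DigitsLE.length_tableSyms_le {N : ℕ} {T : List Entry} (h : DigitsLE N T) :
    (tableSyms T).length ≤ T.length * (N + 1) := by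
  induction T with
  | nil => simp
  | cons e T ih =>
    have h₁ := h e List.mem_cons_self
    have h₂ := ih fun e he => h e (List.mem_cons_of_mem _ he)
    simp only [tableSyms_cons, List.length_append, length_block, List.length_cons, Nat.add_mul,
      Nat.one_mul]
    omega

theorem DigitsLE.reject {N : ℕ} {T : List Entry} (h : DigitsLE N T) :
    DigitsLE (N + 1) (rejectTable T) := by
  intro e he
  obtain ⟨a, ha, rfl⟩ := List.mem_map.1 he
  have := h a ha
  simp only [Entry.length_digits, List.length_cons] at this ⊢
  omega

/-- The `2` accounts for the new choice digit and a possible final carry. -/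
theorem DigitsLE.accept {N : ℕ} {T : List Entry} (h : DigitsLE N T) (c : List Bool) :
    DigitsLE (N + c.length + 2) (acceptTable c T) := by
  intro e he
  obtain ⟨a, ha, rfl⟩ := List.mem_map.1 he
  have := h a ha
  have := length_addBits_le false a.2 c
  simp only [Entry.length_digits, List.length_cons] at *
  omega

theorem DigitsLE.dupHead {N : ℕ} {T : List Entry} (h : DigitsLE N T) : DigitsLE N (dupHead T) := by
  cases T with
  | nil => exact h
  | cons e T =>
    intro a ha
    rcases List.mem_cons.1 ha with rfl | ha
    · exact h _ List.mem_cons_self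
    · exact h a ha

theorem DigitsLE.shift {N : ℕ} {T : List Entry} (h : DigitsLE N T) (col : List Bool) :
    DigitsLE N (shiftTable col T) := by
  induction col generalizing T with
  | nil => exact h
  | cons b col ih =>
    cases b
    · exact ih h
    · exact ih h.dupHead

theorem DigitsLE.merge {N : ℕ} {T U : List Entry} (hT : DigitsLE N T) (hU : DigitsLE N U) :
    DigitsLE N (mergeTables T U) := by
  induction T generalizing U with
  | nil => cases U <;> exact hU
  | cons a T ih =>
    cases U with
    | nil => exact hU
    | cons u U =>
      intro e he
      rcases List.mem_cons.1 he with rfl | he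
      · split_ifs
        · exact hT a List.mem_cons_self
        · exact hU u List.mem_cons_self
      · exact ih (fun e he => hT e (List.mem_cons_of_mem _ he))
          (fun e he => hU e (List.mem_cons_of_mem _ he)) e he

/-- The growth is additive: the cost bits plus two, which is at most the length of the item's two
input blocks with their end markers. -/
theorem DigitsLE.step {N : ℕ} {T : List Entry} (h : DigitsLE N T) (p : ItemData) :
    DigitsLE (N + p.1.length + 2) (stepTable T p) :=
  (h.reject.mono (by omega)).merge ((h.accept p.1).shift p.2)

theorem length_le_length_shiftTable {T : List Entry} (hT : T ≠ []) (p : ItemData) :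
    (rejectTable T).length ≤ (shiftTable p.2 (acceptTable p.1 T)).length := by
  rw [length_shiftTable _ (by simpa [acceptTable] using hT)]
  simp [rejectTable, acceptTable]

theorem length_stepTable {T : List Entry} (hT : T ≠ []) (p : ItemData) :
    (stepTable T p).length = p.2.count true + T.length := by
  rw [stepTable, length_mergeTables (length_le_length_shiftTable hT p),
    length_shiftTable _ (by simpa [acceptTable] using hT), acceptTable, List.length_map]

/-! ### Programs for one item -/

/-- Process the top entry of `T`: move it to `R`, with the latest item not selected, and write the
entry with the latest item selected, whose cost is on the stack `C`, to `S`. -/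
def addEntry : Cmd :=
  .seq (.ops [clearReg, pushSym .R (some (.choice false)), pushSym .S (some (.choice true))])
    (.seq (.loop [peekX .T] (fun r => isChoice r.x) (.ops [dropTop .T, pushX .R, pushX .S, clearReg]))
    (.seq (.ops [clearReg])
    (.seq (.loop [peekX .T, peekY .C] (fun r => isDigit r.x || r.y.isSome)
      (.ops [.pop (fun r => isDigit r.x) .T fun r _ => r,
        .push (fun r => isDigit r.x) .R (·.x.join),
        .pop (fun r => r.y.isSome) .C fun r _ => r, .push (fun r => r.y.isSome) .A (·.y.join),
        .push (fun _ => true) .S fun r => some (.bit (bitOf r.x ^^ (bitOf r.y ^^ r.flag))),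
        .load fun r => .ofFlag (Bool.atLeastTwo (bitOf r.x) (bitOf r.y) r.flag)]))
    (.seq (.ops [.push (·.flag) .S fun _ => some (.bit true), dropTop .T, pushSym .R none,
        pushSym .S none, setFlag false])
      (pour .A .C)))))

/-- The symbols of a binary number. -/
def bitSyms (l : List Bool) : List Sym := l.map fun b => some (.bit b)

@[simp] theorem length_bitSyms (l : List Bool) : (bitSyms l).length = l.length := by
  simp [bitSyms]

/-- The carry `f'` pending at the end becomes a digit only after the loop, hence the splitting of
the sum. The digits of `C` are saved on `A`, since every entry of the table needs them again. -/
theorem exec_addLoop (i o) (t u b l : List Sym) : ∀ (xs ys : List Bool) (f : Bool)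
    (r s a : List Sym), ∃ (zs : List Bool) (f' : Bool),
    addBits f xs ys = zs ++ (bif f' then [true] else []) ∧
    Exec (.loop [peekX .T, peekY .C] (fun r => isDigit r.x || r.y.isSome)
      (.ops [.pop (fun r => isDigit r.x) .T fun r _ => r,
        .push (fun r => isDigit r.x) .R (·.x.join),
        .pop (fun r => r.y.isSome) .C fun r _ => r, .push (fun r => r.y.isSome) .A (·.y.join),
        .push (fun _ => true) .S fun r => some (.bit (bitOf r.x ^^ (bitOf r.y ^^ r.flag))),
        .load fun r => .ofFlag (Bool.atLeastTwo (bitOf r.x) (bitOf r.y) r.flag)]))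
      ⟨.ofFlag f, i, o, ⟨block (xs.map .bit) ++ t, u, r, s, a, b, bitSyms ys, l⟩⟩
      ⟨⟨some none, none, none, f'⟩, i, o, ⟨none :: t, u, (bitSyms xs).reverse ++ r,
        (bitSyms zs).reverse ++ s, (bitSyms ys).reverse ++ a, b, [], l⟩⟩
      (2 * (xs.length + ys.length) + 1) := by
  intro xs
  induction xs with
  | nil =>
    intro ys
    induction ys with
    | nil => exact fun f r s a => ⟨[], f, by cases f <;> rfl, Exec.loop_exit rfl⟩
    | cons y ys ih =>
      intro f r s a
      obtain ⟨zs, f', hz, h⟩ := ih (y && f) r (some (.bit (y ^^ f)) :: s) (some (.bit y) :: a)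
      refine ⟨(y ^^ f) :: zs, f', congrArg (List.cons (y ^^ f)) hz,
        Exec.cast (Exec.loop_step rfl ((Exec.ops _ _).cast ?_ le_rfl) h) ?_ ?_⟩
      · cases y <;> cases f <;> rfl
      · simp [bitSyms]
      · simp only [List.length_cons]
        omega
  | cons x xs ih =>
    intro ys f r s a
    cases ys with
    | nil =>
      obtain ⟨zs, f', hz, h⟩ := ih [] (x && f) (some (.bit x) :: r) (some (.bit (x ^^ f)) :: s) a
      refine ⟨(x ^^ f) :: zs, f', congrArg (List.cons (x ^^ f)) hz,
        Exec.cast (Exec.loop_step rfl ((Exec.ops _ _).cast ?_ le_rfl) h) ?_ ?_⟩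
      · cases x <;> cases f <;> rfl
      · simp [bitSyms]
      · simp only [List.length_cons]
        omega
    | cons y ys =>
      obtain ⟨zs, f', hz, h⟩ := ih ys (Bool.atLeastTwo x y f) (some (.bit x) :: r)
        (some (.bit (x ^^ (y ^^ f))) :: s) (some (.bit y) :: a)
      refine ⟨(x ^^ (y ^^ f)) :: zs, f', congrArg (List.cons (x ^^ (y ^^ f))) hz,
        Exec.cast (Exec.loop_step rfl ((Exec.ops _ _).cast ?_ le_rfl) h) ?_ ?_⟩
      · rfl
      · simp [bitSyms]
      · simp only [List.length_cons]
        omega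

theorem exec_choiceLoop (f i o) (t u b c l : List Sym) (xs ys : List Bool) (r s a : List Sym) :
    Exec (.loop [peekX .T] (fun r => isChoice r.x)
        (.ops [dropTop .T, pushX .R, pushX .S, clearReg]))
      ⟨.ofFlag f, i, o, ⟨block (Entry.digits (xs, ys)) ++ t, u, r, s, a, b, c, l⟩⟩
      ⟨⟨(block (ys.map .bit) ++ t).head?, none, none, f⟩, i, o, ⟨block (ys.map .bit) ++ t, u,
        (xs.map fun b => some (.choice b)).reverse ++ r,
        (xs.map fun b => some (.choice b)).reverse ++ s, a, b, c, l⟩⟩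
      (2 * xs.length + 1) := by
  induction xs generalizing r s with
  | nil => cases ys <;> exact Exec.loop_exit rfl
  | cons x xs ih =>
    refine (Exec.loop_step rfl (.ops _ _)
      (ih (some (.choice x) :: r) (some (.choice x) :: s))).cast ?_ ?_
    · simp
    · simp only [List.length_cons]
      omega

/-- The register `x` is arbitrary because the test of the surrounding loop leaves a peeked symbol
there. -/
theorem exec_addEntry (x : Option Sym) (i o) (t u r s b l : List Sym) (e : Entry)
    (c : List Bool) :
    Exec addEntry
      ⟨⟨x, none, none, false⟩, i, o, ⟨block e.digits ++ t, u, r, s, [], b, bitSyms c, l⟩⟩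
      ⟨.ofFlag false, i, o, ⟨t, u, (block (Entry.digits (false :: e.1, e.2))).reverse ++ r,
        (block (Entry.digits (true :: e.1, addBits false e.2 c))).reverse ++ s, [], b,
        bitSyms c, l⟩⟩
      (2 * e.digits.length + 4 * c.length + 6) := by
  obtain ⟨xs, ys⟩ := e
  obtain ⟨zs, f', hz, h⟩ := exec_addLoop i o t u b l ys c false
    ((xs.map fun b => some (.choice b)).reverse ++ (some (.choice false) :: r))
    ((xs.map fun b => some (.choice b)).reverse ++ (some (.choice true) :: s)) []
  refine Exec.cast (.seq (.ops _ _) (.seq (exec_choiceLoop _ _ _ _ _ _ _ _ xs ys _ _ _)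
    (.seq (.ops _ _) (.seq h (.seq (.ops _ _) (exec_pour (by decide) _ _ _ _)))))) ?_ ?_
  · cases f' <;> simp [Op.run, Mem.get, Mem.set, block, Entry.digits, hz, bitSyms,
      Function.comp_def]
  · cases f' <;> simp [Op.run, Mem.get, Mem.set] <;> omega

/-- Process all entries of `T`: afterwards, `T` is the table in which the latest item is not
selected, and `U` is the table in which it is. -/
def buildTables : Cmd :=
  .seq (.loop [peekX .T] (fun r => r.x.isSome) addEntry) (.seq (pour .R .T) (pour .S .U))

theorem exec_buildTables (i o) (l : List Sym) (T : List Entry) (c : List Bool) {N : ℕ}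
    (hT : DigitsLE N T) (hTN : T.length ≤ N) (hcN : c.length ≤ N) :
    Exec buildTables
      ⟨.ofFlag false, i, o, ⟨tableSyms T, [], [], [], [], [], bitSyms c, l⟩⟩
      ⟨.ofFlag false, i, o, ⟨tableSyms (rejectTable T), tableSyms (acceptTable c T),
        [], [], [], [], bitSyms c, l⟩⟩
      (12 * (N + 2) ^ 2) := by
  -- Both tables pile up entirely reversed on `R` and `S`, so one pour each restores the order of
  -- the entries and of their digits.
  have h (r s : List Sym) : Exec (.loop [peekX .T] (fun r => r.x.isSome) addEntry)
      ⟨.ofFlag false, i, o, ⟨tableSyms T, [], r, s, [], [], bitSyms c, l⟩⟩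
      ⟨.ofFlag false, i, o, ⟨[], [], (tableSyms (rejectTable T)).reverse ++ r,
        (tableSyms (acceptTable c T)).reverse ++ s, [], [], bitSyms c, l⟩⟩
      (T.length * (6 * N + 7) + 1) := by
    clear hTN
    induction T generalizing r s with
    | nil => exact (Exec.loop_exit rfl).cast rfl (by simp)
    | cons e T ih =>
      have he := hT e List.mem_cons_self
      refine (Exec.loop_step ?_ (exec_addEntry _ _ _ _ _ _ _ _ _ _ _)
        (ih (fun e he => hT e (List.mem_cons_of_mem _ he)) _ _)).cast ?_ ?_
      · simp [Op.run, Mem.get, block]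
      · simp [rejectTable, acceptTable]
      · simp only [List.length_cons, Nat.add_mul, Nat.one_mul]
        omega
  have h₁ := hT.reject.length_tableSyms_le
  have h₂ := (hT.accept c).length_tableSyms_le
  refine ((h [] []).seq (.seq (exec_pour (by decide) _ _ _ _)
    (exec_pour (by decide) _ _ _ _))).cast ?_ ?_
  · simp [Mem.get, Mem.set]
  · simp only [rejectTable, acceptTable, List.length_map] at h₁ h₂
    simp [Mem.get, Mem.set, rejectTable, acceptTable]
    nlinarith [Nat.mul_le_mul hTN (show 6 * N + 7 ≤ 6 * N + 7 from le_rfl),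
      Nat.mul_le_mul hTN (show N + 1 + 1 ≤ N + 2 from le_rfl),
      Nat.mul_le_mul hTN (show N + c.length + 2 + 1 ≤ 2 * N + 3 by omega)]

/-- Read the approvals of an item and shift the table on `U` accordingly. -/
def readApprovals : Cmd :=
  .seq (.loop [popI] (fun r => r.i.join.isSome)
    (.ite [] (fun r => r.i.join == some true) (.seq (.ops [clearReg]) dupBlock) (.ops [clearReg])))
    (.ops [clearReg])

/-- Every approval bit duplicates the top entry as it is read, so approvals are never counted.
Nonemptiness of `U` ensures that there is an entry to duplicate. -/
theorem exec_readApprovals (i o) (t r s c l : List Sym) (U : List Entry) (hU : U ≠ [])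
    (col : List Bool) {N : ℕ} (hUN : DigitsLE N U) :
    Exec readApprovals
      ⟨.ofFlag false, inputBlock col ++ i, o, ⟨t, tableSyms U, r, s, [], [], c, l⟩⟩
      ⟨.ofFlag false, i, o, ⟨t, tableSyms (shiftTable col U), r, s, [], [], c, l⟩⟩
      (col.length * (6 * N + 8) + 2) := by
  suffices h : Exec (.loop [popI] (fun r => r.i.join.isSome)
      (.ite [] (fun r => r.i.join == some true) (.seq (.ops [clearReg]) dupBlock)
        (.ops [clearReg])))
      ⟨.ofFlag false, inputBlock col ++ i, o, ⟨t, tableSyms U, r, s, [], [], c, l⟩⟩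
      ⟨⟨none, none, some none, false⟩, i, o,
        ⟨t, tableSyms (shiftTable col U), r, s, [], [], c, l⟩⟩
      (col.length * (6 * N + 8) + 1) from (h.seq (.ops _ _)).cast rfl le_rfl
  induction col generalizing U with
  | nil => exact (Exec.loop_exit rfl).cast rfl (by simp)
  | cons b col ih =>
    obtain ⟨e, U, rfl⟩ := List.exists_cons_of_ne_nil hU
    have he := hUN e List.mem_cons_self
    cases b
    · refine (Exec.loop_step rfl (.ite_false rfl (.ops _ _)) (ih (e :: U) hU hUN)).cast rfl ?_
      simp only [List.length_cons, Nat.add_mul, Nat.one_mul]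
      omega
    · refine (Exec.loop_step rfl (.ite_true rfl (.seq (.ops _ _)
        (exec_dupBlock _ _ _ _ (tableSyms U) _ _ _ _ e.digits)))
        (ih (e :: e :: U) (by simp) hUN.dupHead)).cast rfl ?_
      simp only [List.length_cons, Nat.add_mul, Nat.one_mul]
      omega

/-- Merge the tables on `T` and `U` into `T`. -/
def mergeCmd : Cmd :=
  .seq (.loop [peekX .T] (fun r => r.x.isSome)
    (.seq (.ops [setFlag true]) (.seq (compareBlocks .U)
      (.ite [] (fun r => r.flag)
        (.seq (.ops [setFlag false]) (.seq (moveBlock .T .R) (dropBlock .U)))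
        (.seq (.ops [setFlag false]) (.seq (moveBlock .U .R) (dropBlock .T)))))))
    (.seq (pour .U .R) (pour .R .T))

theorem exec_mergeCmd (i o) (c l : List Sym) {T U : List Entry} {N M : ℕ}
    (hle : T.length ≤ U.length) (hT : DigitsLE N T) (hU : DigitsLE N U) (hM : U.length ≤ M) :
    Exec mergeCmd
      ⟨.ofFlag false, i, o, ⟨tableSyms T, tableSyms U, [], [], [], [], c, l⟩⟩
      ⟨.ofFlag false, i, o, ⟨tableSyms (mergeTables T U), [], [], [], [], [], c, l⟩⟩
      (M * (16 * N + 16) + 3) := by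
  -- The loop stops when `T` is exhausted, with the merged part `M₁` reversed on `R` and the rest
  -- `U'` untouched. Pouring `U` onto `R` and then `R` onto `T` yields `M₁ ++ U'`.
  have h (r : List Sym) : ∃ M₁ U', mergeTables T U = M₁ ++ U' ∧
      Exec (.loop [peekX .T] (fun r => r.x.isSome)
        (.seq (.ops [setFlag true]) (.seq (compareBlocks .U)
          (.ite [] (fun r => r.flag)
            (.seq (.ops [setFlag false]) (.seq (moveBlock .T .R) (dropBlock .U)))
            (.seq (.ops [setFlag false]) (.seq (moveBlock .U .R) (dropBlock .T)))))))
        ⟨.ofFlag false, i, o, ⟨tableSyms T, tableSyms U, r, [], [], [], c, l⟩⟩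
        ⟨.ofFlag false, i, o,
          ⟨[], tableSyms U', (tableSyms M₁).reverse ++ r, [], [], [], c, l⟩⟩
        (T.length * (12 * N + 12) + 1) := by
    clear hM
    induction T generalizing U r with
    | nil => exact ⟨[], U, by cases U <;> rfl, (Exec.loop_exit rfl).cast rfl (by simp)⟩
    | cons e T ih =>
      cases U with
      | nil => simp at hle
      | cons u U =>
        have he := hT e List.mem_cons_self
        have hu := hU u List.mem_cons_self
        have hcmp := exec_compareBlocks (b := .U) (by decide) (by decide) (by decide) i o
          (m := ⟨tableSyms (e :: T), tableSyms (u :: U), r, [], [], [], c, l⟩)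
          (xs := e.digits) (ys := u.digits) (t := tableSyms T) (u := tableSyms U) rfl rfl rfl rfl
        have hp : (runOps [peekX .T] ⟨.ofFlag false, i, o,
            ⟨tableSyms (e :: T), tableSyms (u :: U), r, [], [], [], c, l⟩⟩).reg.x.isSome = true := by
          simp [Op.run, Mem.get, block]
        by_cases hlt : digitsVal e.digits ≤ digitsVal u.digits
        · rw [decide_eq_true hlt] at hcmp
          obtain ⟨M₁, U', hm, h⟩ := ih (by simpa using hle)
            (fun e he => hT e (List.mem_cons_of_mem _ he))
            (fun e he => hU e (List.mem_cons_of_mem _ he)) ((block e.digits).reverse ++ r)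
          refine ⟨e :: M₁, U', by simp [mergeTables, hlt, hm],
            (Exec.loop_step hp (.seq (.ops _ _) (.seq hcmp (.ite_true rfl (.seq (.ops _ _)
              (.seq (exec_moveBlock (by decide) _ _ _ _ (l := e.digits) (t := tableSyms T) rfl)
                (exec_dropBlock _ _ _ _ (l := u.digits) (t := tableSyms U) rfl)))))) h).cast
              ?_ ?_⟩
          · simp
          · simp only [List.length_cons, Nat.add_mul, Nat.one_mul]
            omega
        · rw [decide_eq_false hlt] at hcmp
          obtain ⟨M₁, U', hm, h⟩ := ih (by simpa using hle)
            (fun e he => hT e (List.mem_cons_of_mem _ he))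
            (fun e he => hU e (List.mem_cons_of_mem _ he)) ((block u.digits).reverse ++ r)
          refine ⟨u :: M₁, U', by simp [mergeTables, hlt, hm],
            (Exec.loop_step hp (.seq (.ops _ _) (.seq hcmp (.ite_false rfl (.seq (.ops _ _)
              (.seq (exec_moveBlock (by decide) _ _ _ _ (l := u.digits) (t := tableSyms U) rfl)
                (exec_dropBlock _ _ _ _ (l := e.digits) (t := tableSyms T) rfl)))))) h).cast
              ?_ ?_⟩
          · simp
          · simp only [List.length_cons, Nat.add_mul, Nat.one_mul]
            omega
  obtain ⟨M₁, U', hm, h⟩ := h []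
  have hsz : (tableSyms M₁).length + (tableSyms U').length ≤ M * (N + 1) := by
    have := (hT.merge hU).length_tableSyms_le
    rw [length_mergeTables hle, hm, tableSyms_append, List.length_append] at this
    exact this.trans (Nat.mul_le_mul_right _ hM)
  have hTM := Nat.mul_le_mul_right (12 * N + 12) (hle.trans hM)
  refine (h.seq (.seq (exec_pour (by decide) _ _ _ _) (exec_pour (by decide) _ _ _ _))).cast ?_ ?_
  · simp [Mem.get, Mem.set, hm]
  · simp [Mem.get, Mem.set]
    nlinarith

/-- Process one item. -/
def processItem : Cmd :=
  .seq (readBlock .C) (.seq buildTables (.seq readApprovals (.seq (clear .C)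
    (.seq mergeCmd (.ops [pushSym .L (some (.choice false))])))))

/-- The choice digit pushed on `L` gives the limit as many choice digits as the new entries have, as
later comparisons require. -/
theorem exec_processItem (i o) (l : List Sym) {T : List Entry} (hT : T ≠ []) (p : ItemData) {N : ℕ}
    (hTN : DigitsLE N T) (hlen : T.length + p.2.length ≤ N) (hpN : p.1.length ≤ N) :
    Exec processItem
      ⟨.ofFlag false, inputBlock p.1 ++ (inputBlock p.2 ++ i), o,
        ⟨tableSyms T, [], [], [], [], [], [], l⟩⟩
      ⟨.ofFlag false, i, o,
        ⟨tableSyms (stepTable T p), [], [], [], [], [], [], some (.choice false) :: l⟩⟩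
      (80 * (N + 2) ^ 2) := by
  have hacc : acceptTable p.1 T ≠ [] := by simpa [acceptTable] using hT
  have hTU : DigitsLE (2 * N + 2) (acceptTable p.1 T) := (hTN.accept p.1).mono (by omega)
  have hlenU : (shiftTable p.2 (acceptTable p.1 T)).length ≤ N := by
    rw [length_shiftTable _ hacc, acceptTable, List.length_map]
    have := List.count_le_length (a := true) (l := p.2)
    omega
  have h₁ := (exec_readBlock (w := .C) (by decide) false (inputBlock p.2 ++ i) o
    ⟨tableSyms T, [], [], [], [], [], [], l⟩ p.1 rfl).cast (s₂ := ⟨.ofFlag false,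
      inputBlock p.2 ++ i, o, ⟨tableSyms T, [], [], [], [], [], bitSyms p.1, l⟩⟩)
    (by simp [Mem.set, Mem.get, bitSyms]) le_rfl
  have h₂ := exec_buildTables (inputBlock p.2 ++ i) o l T p.1 hTN (by omega) hpN
  have h₃ := exec_readApprovals i o (tableSyms (rejectTable T)) [] [] (bitSyms p.1) l _ hacc p.2 hTU
  have h₄ := exec_clear .C false i o ⟨tableSyms (rejectTable T),
    tableSyms (shiftTable p.2 (acceptTable p.1 T)), [], [], [], [], bitSyms p.1, l⟩
  have h₅ := exec_mergeCmd i o [] l (length_le_length_shiftTable hT p)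
    (hTN.reject.mono (show N + 1 ≤ 2 * N + 2 by omega)) (hTU.shift p.2) hlenU
  refine (h₁.seq (h₂.seq (h₃.seq (h₄.seq (h₅.seq (.ops _ _)))))).cast rfl ?_
  · simp only [Mem.get, length_bitSyms]
    have := Nat.mul_le_mul_right (6 * (2 * N + 2) + 8) (show p.2.length ≤ N by omega)
    nlinarith

/-- Process all items. -/
def processItems : Cmd :=
  .loop [.peekInput fun r a => { r with i := a }] (fun r => r.i.isSome)
    (.seq (.ops [clearReg]) processItem)

/-- The input blocks of the items. -/
def itemBlocks (its : List ItemData) : List (Option Bool) :=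
  its.flatMap fun p => inputBlock p.1 ++ inputBlock p.2

theorem itemBlocks_cons (p : ItemData) (its : List ItemData) :
    itemBlocks (p :: its) = inputBlock p.1 ++ (inputBlock p.2 ++ itemBlocks its) := by
  simp [itemBlocks]

/-- The remaining input serves as a potential: an item lengthens entries and table by at most the
length of its own blocks, so both sums in the hypotheses stay below `N`. -/
theorem exec_processItems (o) (l : List Sym) {T : List Entry} (hT : T ≠ []) (its : List ItemData)
    {N n : ℕ} (hTn : DigitsLE n T) (hn : n + (itemBlocks its).length ≤ N)
    (hlen : T.length + (itemBlocks its).length ≤ N) :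
    Exec processItems
      ⟨.ofFlag false, itemBlocks its, o, ⟨tableSyms T, [], [], [], [], [], [], l⟩⟩
      ⟨.ofFlag false, [], o, ⟨tableSyms (its.foldl stepTable T), [], [], [], [], [], [],
        List.replicate its.length (some (.choice false)) ++ l⟩⟩
      (its.length * (80 * (N + 2) ^ 2 + 2) + 1) ∧
    DigitsLE N (its.foldl stepTable T) ∧ (its.foldl stepTable T).length ≤ N := by
  induction its generalizing T n l with
  | nil => exact ⟨(Exec.loop_exit rfl).cast rfl (by simp), hTn.mono (by omega),
    (Nat.le_add_right _ _).trans hlen⟩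
  | cons p its ih =>
    rw [itemBlocks_cons] at hn hlen ⊢
    simp only [List.length_append, length_inputBlock] at hn hlen
    have hcount := List.count_le_length (a := true) (l := p.2)
    have hlen' := length_stepTable hT p
    obtain ⟨h₁, h₂, h₃⟩ := ih (some (.choice false) :: l) (T := stepTable T p)
      (n := n + p.1.length + 2) (by
        intro h
        rw [h] at hlen'
        have := List.length_pos_of_ne_nil hT
        simp at hlen'
        omega) (hTn.step p) (by omega) (by omega)
    refine ⟨(Exec.loop_step ?_ (.seq (.ops _ _)
      (exec_processItem _ _ _ hT p (hTn.mono (show n ≤ N by omega))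
        (by omega) (by omega))) h₁).cast ?_ ?_,
      h₂, h₃⟩
    -- Even a cost block without bits has its end marker, so the test for further input succeeds.
    · cases h : p.1 <;> simp [Op.run, inputBlock]
    · simp only [List.length_cons, List.foldl_cons, State.mk.injEq, true_and, Mem.mk.injEq]
      rw [List.replicate_succ', List.append_assoc]
      rfl
    · simp only [List.length_cons, Nat.add_mul, Nat.one_mul]
      omega

/-! ### Selection of the best entry and output -/

/-- Find the last entry within the limit and write it to `R`. -/
def selectBest : Cmd :=
  .loop [peekX .T] (fun r => r.x.isSome)
    (.seq (.ops [setFlag true]) (.seq (compareBlocks .L)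
      (.ite [] (fun r => r.flag)
        (.seq (.ops [setFlag false]) (.seq (clear .R) (moveBlock .T .R)))
        (.seq (.ops [setFlag false]) (dropBlock .T)))))

/-- The length of the current best entry is bounded along the way because erasing it from `R` is
part of the running time. -/
theorem exec_selectBest (i o) (lim : List Digit) (T : List Entry) (b : Entry) {N : ℕ}
    (hT : DigitsLE N T) (hb : b.digits.length ≤ N) (hlim : lim.length ≤ N) :
    Exec selectBest
      ⟨.ofFlag false, i, o,
        ⟨tableSyms T, [], (block b.digits).reverse, [], [], [], [], block lim⟩⟩
      ⟨.ofFlag false, i, o, ⟨[], [],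
        (block (lastEntry (fun e => digitsVal e.digits ≤ digitsVal lim) b T).digits).reverse,
        [], [], [], [], block lim⟩⟩
      (T.length * (12 * N + 14) + 1) ∧
    (lastEntry (fun e => digitsVal e.digits ≤ digitsVal lim) b T).digits.length ≤ N := by
  induction T generalizing b with
  | nil => exact ⟨(Exec.loop_exit rfl).cast rfl (by simp), hb⟩
  | cons e T ih =>
    have he := hT e List.mem_cons_self
    have hcmp := exec_compareBlocks (b := .L) (by decide) (by decide) (by decide) i o
      (m := ⟨tableSyms (e :: T), [], (block b.digits).reverse, [], [], [], [], block lim⟩)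
      (xs := e.digits) (ys := lim) (t := tableSyms T) (u := []) rfl
      (List.append_nil _).symm rfl rfl
    have hp : (runOps [peekX .T] ⟨.ofFlag false, i, o,
        ⟨tableSyms (e :: T), [], (block b.digits).reverse, [], [], [], [],
          block lim⟩⟩).reg.x.isSome = true := by
      simp [Op.run, Mem.get, block]
    have hT' : DigitsLE N T := fun e he => hT e (List.mem_cons_of_mem _ he)
    by_cases hle : digitsVal e.digits ≤ digitsVal lim
    · rw [decide_eq_true hle] at hcmp
      obtain ⟨h₁, h₂⟩ := ih e hT' he
      have hl : lastEntry (fun e => digitsVal e.digits ≤ digitsVal lim) b (e :: T) =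
          lastEntry (fun e => digitsVal e.digits ≤ digitsVal lim) e T := by
        simp [lastEntry, hle]
      rw [hl]
      refine ⟨(Exec.loop_step hp (.seq (.ops _ _) (.seq hcmp (.ite_true rfl (.seq (.ops _ _)
        (.seq (exec_clear .R false i o
            ⟨tableSyms (e :: T), [], (block b.digits).reverse, [], [], [], [], block lim⟩)
          ((exec_moveBlock (by decide) _ _ _ _ (l := e.digits) (t := tableSyms T) rfl).cast
            (s₂ := ⟨.ofFlag false, i, o,
              ⟨tableSyms T, [], (block e.digits).reverse, [], [], [], [], block lim⟩⟩)
            ?_ le_rfl)))))) h₁).cast rfl ?_, h₂⟩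
      · simp [Mem.get, Mem.set]
      · simp only [List.length_cons, Nat.add_mul, Nat.one_mul, Mem.get, List.length_reverse,
          length_block]
        omega
    · rw [decide_eq_false hle] at hcmp
      obtain ⟨h₁, h₂⟩ := ih b hT' hb
      have hl : lastEntry (fun e => digitsVal e.digits ≤ digitsVal lim) b (e :: T) =
          lastEntry (fun e => digitsVal e.digits ≤ digitsVal lim) b T := by
        simp [lastEntry, hle]
      rw [hl]
      refine ⟨(Exec.loop_step hp (.seq (.ops _ _) (.seq hcmp (.ite_false rfl (.seq (.ops _ _)
        (exec_dropBlock _ _ _ _ (l := e.digits) (t := tableSyms T) rfl))))) h₁).cast rfl ?_, h₂⟩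
      simp only [List.length_cons, Nat.add_mul, Nat.one_mul]
      omega

/-- Write the choice digits on the stack `A` to the output. -/
def writeChoices : Cmd :=
  .loop [popX .A] (fun r => r.x.isSome)
    (.ops [.pushOutput (fun r => isChoice r.x) fun r => choiceOf r.x, clearReg])

/-- The output is itself a stack: pushing the choices latest item first leaves the first item on
top. Cost bits and the end marker produce no output. -/
theorem exec_writeChoices (i o) (e : Entry) :
    Exec writeChoices
      ⟨.ofFlag false, i, o, ⟨[], [], [], [], block e.digits, [], [], []⟩⟩
      ⟨.ofFlag false, i, e.1.reverse ++ o, ⟨[], [], [], [], [], [], [], []⟩⟩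
      (2 * e.digits.length + 3) := by
  obtain ⟨xs, ys⟩ := e
  unfold writeChoices
  induction xs generalizing o with
  | nil =>
    induction ys with
    | nil => exact (Exec.loop_step rfl (.ops _ _) (.loop_exit rfl)).cast rfl (by simp)
    | cons y ys ih =>
      refine (Exec.loop_step rfl (.ops _ _) ih).cast rfl ?_
      simp only [Entry.length_digits, List.length_cons]
      omega
  | cons x xs ih =>
    refine (Exec.loop_step rfl (.ops _ _) (ih (x :: o))).cast ?_ ?_
    · simp
    · simp only [Entry.length_digits, List.length_cons]
      omega

/-- The whole program. -/
def knapsackCmd : Cmd :=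
  .seq skipBlock (.seq (.ops [pushSym .L none]) (.seq (readBlock .L)
    (.seq (.ops [pushSym .T none]) (.seq processItems (.seq (.ops [pushSym .R none])
      (.seq selectBest (.seq (clear .L) (.seq (pour .R .A) writeChoices))))))))

/-- The number of voters can be skipped since end markers delimit the columns. A lone end marker is
the block of the empty entry, so it serves both as initial table on `T` and as default result on
`R`. -/
theorem exec_knapsackCmd (w lim : List Bool) (its : List ItemData) {N : ℕ}
    (hN : (inputBlock w ++ (inputBlock lim ++ itemBlocks its)).length ≤ N) :
    Exec knapsackCmd (ioState (inputBlock w ++ (inputBlock lim ++ itemBlocks its)) [])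
      (ioState [] (bestEntry lim its).1.reverse) (100 * (N + 3) ^ 3) := by
  simp only [List.length_append, length_inputBlock] at hN
  have hits : ∀ its : List ItemData, its.length ≤ (itemBlocks its).length := by
    intro its
    induction its with
    | nil => simp
    | cons p its ih =>
      rw [itemBlocks_cons]
      simp only [List.length_append, length_inputBlock, List.length_cons]
      omega
  have hits := hits its
  obtain ⟨h₁, h₂, h₃⟩ := exec_processItems [] (block (lim.map .bit)) (T := initTable)
    (by simp [initTable]) its (n := 0) (N := N) (by simp [DigitsLE, initTable, Entry.digits])
    (by omega) (by simp [initTable]; omega)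
  have hlimlen : (limitDigits lim its.length).length ≤ N := by
    simp [limitDigits]
    omega
  -- The choice digits collected on `L`, one per item, turn the block of the limit into
  -- `limitDigits`.
  have hlim : List.replicate its.length (some (Digit.choice false)) ++ block (lim.map .bit) =
      block (limitDigits lim its.length) := by
    simp [limitDigits, block, Entry.digits]
  rw [hlim] at h₁
  obtain ⟨h₄, h₅⟩ := exec_selectBest [] [] (limitDigits lim its.length)
    (its.foldl stepTable initTable) ([], []) h₂ (by simp) hlimlen
  change Exec _ _ ⟨_, _, _, ⟨_, _, (block (bestEntry lim its).digits).reverse, _, _, _, _, _⟩⟩ _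
    at h₄
  change (bestEntry lim its).digits.length ≤ N at h₅
  refine (Exec.seq (exec_skipBlock _ _ _ _ _) (.seq (.ops _ _)
    (.seq ((exec_readBlock (by decide) _ _ _ _ lim rfl).cast (s₂ := ⟨.ofFlag false, itemBlocks its,
      [], ⟨[], [], [], [], [], [], [], block (lim.map .bit)⟩⟩) ?_ le_rfl) (.seq (.ops _ _)
      (.seq h₁ (.seq (.ops _ _) (.seq h₄ (.seq (exec_clear _ _ _ _ _)
        (.seq ((exec_pour (by decide) _ _ _ _).cast (s₂ := ⟨.ofFlag false, [], [],
          ⟨[], [], [], [], block (bestEntry lim its).digits, [], [], []⟩⟩) ?_ le_rfl)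
          (exec_writeChoices _ _ _)))))))))).cast ?_ ?_
  · simp [Mem.get, Mem.set, block]
  · simp [Mem.get, Mem.set]
  · simp [ioState]
  -- At most `N` items at quadratic cost each dominate and give the cubic bound.
  · have h₆ := Nat.mul_le_mul_right (80 * (N + 2) ^ 2 + 2) (show its.length ≤ N by omega)
    have h₇ := Nat.mul_le_mul_right (12 * N + 14) h₃
    simp only [Mem.get, Mem.set, List.length_reverse, length_block]
    nlinarith

end StackProgram

/-! ### Budgeting scenarios -/

namespace BudgetingScenario

open StackProgram

/-- The data of an item in the input. -/
def itemData (E : BudgetingScenario) (a : E.Item) : ItemData :=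
  (Computability.encodeNat (E.cost a), List.ofFn fun v : E.Voter => decide (a ∈ E.approvals v))

/-- The data of all items in the input. -/
def items (E : BudgetingScenario) : List ItemData := (List.finRange E.numItems).map E.itemData

@[simp] theorem length_items (E : BudgetingScenario) : E.items.length = E.numItems := by
  simp [items]

theorem encode_eq (E : BudgetingScenario) :
    E.encode = inputBlock (Computability.encodeNat E.numVoters) ++
      (inputBlock (Computability.encodeNat E.limit) ++ itemBlocks E.items) := by
  simp [encode, blocks, itemBlocks, items, inputBlock, itemData, List.flatMap_assoc,
    List.flatMap_map]

theorem cost_itemData (E : BudgetingScenario) (a : E.Item) : (E.itemData a).cost = E.cost a :=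
  bitsVal_encodeNat _

theorem value_itemData (E : BudgetingScenario) (a : E.Item) :
    (E.itemData a).value = ∑ v : E.Voter, if a ∈ E.approvals v then 1 else 0 := by
  have h : ∀ l : List Bool, l.count true = (l.map fun b => if b then 1 else 0).sum := by
    intro l
    induction l with
    | nil => rfl
    | cons b l ih => cases b <;> simp [ih, add_comm]
  rw [ItemData.value, h, itemData, List.map_ofFn, List.sum_ofFn]
  simp

theorem selectedSum_items (E : BudgetingScenario) (w : ItemData → ℕ) (B : Finset E.Item) :
    selectedSum w E.items (encodeBudget B) = ∑ a ∈ B, w (E.itemData a) := by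
  rw [selectedSum, encodeBudget, items, List.ofFn_eq_map, List.zipWith_map, List.zipWith_self,
    ← List.ofFn_eq_map, List.sum_ofFn]
  simp [Bool.cond_decide, Finset.sum_ite_mem]

theorem cost_encodeBudget (E : BudgetingScenario) (B : Finset E.Item) :
    selectedSum ItemData.cost E.items (encodeBudget B) = E.totalCost B := by
  simp [selectedSum_items, cost_itemData, totalCost]

/-- Approvals are counted by item on one side and by voter on the other; exchanging the two sums
identifies them. -/
theorem value_encodeBudget (E : BudgetingScenario) (B : Finset E.Item) :
    selectedSum ItemData.value E.items (encodeBudget B) =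
      totalSatisfaction cardSatisfaction E B := by
  simp only [selectedSum_items, value_itemData, totalSatisfaction, cardSatisfaction]
  rw [Finset.sum_comm]
  refine Finset.sum_congr rfl fun v _ => ?_
  rw [Finset.sum_boole, Finset.inter_comm, ← Finset.filter_mem_eq_inter]
  simp

/-- The output of the program. -/
def knapsackBits (E : BudgetingScenario) : List Bool :=
  (bestEntry (Computability.encodeNat E.limit) E.items).1.reverse

theorem length_knapsackBits (E : BudgetingScenario) : E.knapsackBits.length = E.numItems := by
  simpa [knapsackBits] using (bestEntry_spec (Computability.encodeNat E.limit) E.items).1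

/-- The budget which the program computes. -/
def knapsackBudget (E : BudgetingScenario) : Finset E.Item :=
  Finset.univ.filter fun a => E.knapsackBits[a.val]'(by simp [length_knapsackBits]) = true

theorem encodeBudget_knapsackBudget (E : BudgetingScenario) :
    encodeBudget E.knapsackBudget = E.knapsackBits := by
  refine List.ext_getElem (by simp [encodeBudget, length_knapsackBits]) fun i h₁ h₂ => ?_
  simp [encodeBudget, knapsackBudget]

/-- Every rival budget is encoded by a Boolean list of the right length, so the optimality in
`bestEntry_spec` applies to it. -/
theorem isMaxWinningBudget_knapsackBudget (E : BudgetingScenario) :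
    IsMaxWinningBudget cardSatisfaction E E.knapsackBudget := by
  obtain ⟨-, hcost, hmax⟩ := bestEntry_spec (Computability.encodeNat E.limit) E.items
  change selectedSum _ _ E.knapsackBits ≤ _ at hcost
  change ∀ bs : List Bool, _ → _ → _ ≤ selectedSum _ _ E.knapsackBits at hmax
  rw [← encodeBudget_knapsackBudget, bitsVal_encodeNat, cost_encodeBudget] at hcost
  refine ⟨hcost, fun B hB => ?_⟩
  rw [← value_encodeBudget, ← value_encodeBudget, encodeBudget_knapsackBudget]
  refine hmax _ (by simp [encodeBudget]) ?_
  rw [bitsVal_encodeNat, cost_encodeBudget]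
  exact hB

end BudgetingScenario

theorem mainTheorem9 :
    ∃ R : BudgetingMethod, R.IsMaxRule cardSatisfaction ∧ R.ComputableInPolyTime := by
  refine ⟨⟨BudgetingScenario.knapsackBudget, fun E => E.isMaxWinningBudget_knapsackBudget.1⟩,
    BudgetingScenario.isMaxWinningBudget_knapsackBudget,
    StackProgram.knapsackCmd.computableInPolyTime (100 * (Polynomial.X + 3) ^ 3) fun E => ?_⟩
  have h := StackProgram.exec_knapsackCmd (Computability.encodeNat E.numVoters)
    (Computability.encodeNat E.limit) E.items le_rfl
  rw [← BudgetingScenario.encode_eq] at h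
  refine h.cast ?_ (by simp)
  exact congrArg (StackProgram.ioState []) E.encodeBudget_knapsackBudget.symm
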